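/- **Setting.** Let $\mathcal A,\mathcal E:\mathbb R^{m\times n}\to\mathbb R^M$ be linear, $\hat{\mathcal A}=\mathcal A+\mathcal E$, let $0\neq X\in\mathbb R^{m\times n}$, $z\in\mathbb R^M$, $y=\mathcal A(X)$, $\hat y=y+z$. Let $0<p<1$, let $r\ge 1$ be an integer and $a>1$ a real number such that $ar$ is an integer. Write $\|\cdot\|_F$ for the Frobenius norm, $\|\cdot\|_*$ for the nuclear norm, and $\|Z\|_p=(\sum_i\sigma_i(Z)^p)^{1/p}$ for the Schatten $p$ quasi-norm ($\sigma_i$ the singular values). Let $X_{[r]}$ be a best approximation of $X$ in Frobenius norm among matrices of rank at most $r$, and $X_{[r]^c}=X-X_{[r]}$. For an integer $k\ge1$, let $\delta_k$ be the restricted isometry constant of $\mathcal A$: the smallest $\delta\ge 0$ with $(1-\delta)\|Z\|_F^2\le\|\mathcal A(Z)\|_2^2\le(1+\delta)\|Z\|_F^2$ for all $Z$ with $\operatorname{rank}Z\le k$. Put $\|\mathcal B\|_{op}=\sup_{Z\ne0}\|\mathcal B(Z)\|_2/\|Z\|_F$ and let $\|\mathcal B\|_{op}^{(k)}$ be the same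 supremum over $Z\neq0$ with $\operatorname{rank}Z\le k$. Let $\epsilon_{\mathcal A},\epsilon_{\mathcal A}^{(r)},\epsilon_{\mathcal A}^{((a+1)r)},\epsilon_{\mathcal A}^{(2ar)},\epsilon_y$ be real numbers with $$\frac{\|\mathcal E\|_{op}}{\|\mathcal A\|_{op}}\le\epsilon_{\mathcal A},\qquad \frac{\|\mathcal E\|_{op}^{(k)}}{\|\mathcal A\|_{op}^{(k)}}\le\epsilon_{\mathcal A}^{(k)}\ \ (k\in\{r,(a+1)r,2ar\}),\qquad \frac{\|z\|_2}{\|y\|_2}\le\epsilon_y ,$$ and put $$t_r=\frac{\|X_{[r]^c}\|_F}{\|X_{[r]}\|_F},\quad s_r=\frac{\|X_{[r]^c}\|_*}{\sqrt r\,\|X_{[r]}\|_F},\quad \kappa_{\mathcal A}^{(r)}=\frac{\sqrt{1+\delta_r}}{\sqrt{1-\delta_r}},\quad \alpha_{\mathcal A}=\frac{\|\mathcal A\|_{op}}{\sqrt{1-\delta_r}},$$ $$\hat\delta_k=(1+\delta_k)(1+\epsilon_{\mathcal A}^{(k)})^2-1\quad(k\in\{(a+1)r,2ar\}),\qquad \epsilon'=\left[\frac{\epsilon_{\mathcal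 A}^{(r)}\kappa_{\mathcal A}^{(r)}+\epsilon_{\mathcal A}\alpha_{\mathcal A}t_r}{1-\kappa_{\mathcal A}^{(r)}(t_r+s_r)}+\epsilon_y\right]\|y\|_2 .$$ **Theorem 1.** Suppose that $$\delta_{2ar}<\frac{2+\sqrt2\,a^{1/2-1/p}}{(1+\sqrt2\,a^{1/2-1/p})(1+\epsilon_{\mathcal A}^{(2ar)})^2}-1,\qquad t_r+s_r<\frac1{\kappa_{\mathcal A}^{(r)}},$$ and that $\hat\delta_{(a+1)r}\le\hat\delta_{2ar}$ (which is automatic when $\epsilon_{\mathcal A}^{((a+1)r)}\le\epsilon_{\mathcal A}^{(2ar)}$). Then $\hat\delta_{(a+1)r}<1$, the number $$D=(1-\hat\delta_{(a+1)r})^p-a^{p/2-1}\bigl(\hat\delta_{(a+1)r}^2+\hat\delta_{2ar}^2\bigr)^{p/2}$$ is positive, and every minimizer $X^*$ of $\|Z\|_p^p$ over all $Z\in\mathbb R^{m\times n}$ with $\|\hat{\mathcal A}(Z)-\hat y\|_2\le\epsilon'$ satisfies $$\|X-X^*\|_F^p\le C_1(\epsilon')^p+C_2\frac{\|X_{[r]^c}\|_p^p}{r^{1-p/2}},\qquad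 \|X-X^*\|_p^p\le C_1'\,r^{1-p/2}(\epsilon')^p+C_2'\,\|X_{[r]^c}\|_p^p,$$ where $$C_1=\frac{2^p(1+a^{p/2-1})(1+\hat\delta_{(a+1)r})^{p/2}}{D},\qquad C_2=2a^{p/2-1}\left[1+\frac{(1+a^{p/2-1})(\hat\delta_{(a+1)r}^2+\hat\delta_{2ar}^2)^{p/2}}{D}\right],$$ $$C_1'=\frac{2^{p+1}(1+a)^{1-p/2}(1+\hat\delta_{(a+1)r})^{p/2}}{D},\qquad C_2'=2+\frac{4(1+a)^{1-p/2}a^{p/2-1}(\hat\delta_{(a+1)r}^2+\hat\delta_{2ar}^2)^{p/2}}{D}.$$ -/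

import Mathlib

/-- Frobenius norm `‖X‖_F = √(trace (Xᵀ X))` of a real matrix. -/
noncomputable def frobNorm {m n : ℕ} (X : Matrix (Fin m) (Fin n) ℝ) : ℝ :=
  Real.sqrt (X.transpose * X).trace

/-- The `i`-th largest singular value of a real matrix, counted with multiplicity, `i` starting
from `0`. It vanishes for `i ≥ min m n`. -/
noncomputable def matSingularValue {m n : ℕ} (X : Matrix (Fin m) (Fin n) ℝ) (i : ℕ) : ℝ :=
  (Matrix.toEuclideanLin X).singularValues i

/-- Schatten `p` quasi-norm `‖X‖_p = (∑ i, σ_i(X) ^ p) ^ (1 / p)`, for `p > 0`. -/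
noncomputable def schattenNorm {m n : ℕ} (p : ℝ) (X : Matrix (Fin m) (Fin n) ℝ) : ℝ :=
  (∑ i ∈ Finset.range (min m n), matSingularValue X i ^ p) ^ (1 / p)

/-- Nuclear norm: the sum of the singular values. -/
noncomputable def nuclearNorm {m n : ℕ} (X : Matrix (Fin m) (Fin n) ℝ) : ℝ :=
  ∑ i ∈ Finset.range (min m n), matSingularValue X i

/-- `Xr` is a best approximation of `X` of rank at most `r`. -/
def IsBestRankApprox {m n : ℕ} (r : ℕ) (X Xr : Matrix (Fin m) (Fin n) ℝ) : Prop :=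
  Xr.rank ≤ r ∧
    ∀ Y : Matrix (Fin m) (Fin n) ℝ, Y.rank ≤ r → frobNorm (X - Xr) ≤ frobNorm (X - Y)

/-- Restricted isometry constant of order `k` of a linear transformation: the smallest `δ` such
that `(1 - δ) ‖X‖_F² ≤ ‖A X‖₂² ≤ (1 + δ) ‖X‖_F²` for all `X` of rank at most `k`. -/
noncomputable def ric {m n M : ℕ}
    (A : Matrix (Fin m) (Fin n) ℝ →ₗ[ℝ] EuclideanSpace ℝ (Fin M)) (k : ℕ) : ℝ :=
  sInf {δ : ℝ | 0 ≤ δ ∧ ∀ X : Matrix (Fin m) (Fin n) ℝ, X.rank ≤ k →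
    (1 - δ) * frobNorm X ^ 2 ≤ ‖A X‖ ^ 2 ∧ ‖A X‖ ^ 2 ≤ (1 + δ) * frobNorm X ^ 2}

/-- Operator norm of a linear transformation from (matrices, Frobenius) to Euclidean space. -/
noncomputable def opNorm {m n M : ℕ}
    (A : Matrix (Fin m) (Fin n) ℝ →ₗ[ℝ] EuclideanSpace ℝ (Fin M)) : ℝ :=
  sSup {c : ℝ | ∃ X : Matrix (Fin m) (Fin n) ℝ, X ≠ 0 ∧ c = ‖A X‖ / frobNorm X}

/-- Operator norm restricted to matrices of rank at most `k`. -/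
noncomputable def opNormRank {m n M : ℕ} (k : ℕ)
    (A : Matrix (Fin m) (Fin n) ℝ →ₗ[ℝ] EuclideanSpace ℝ (Fin M)) : ℝ :=
  sSup {c : ℝ | ∃ X : Matrix (Fin m) (Fin n) ℝ, X ≠ 0 ∧ X.rank ≤ k ∧ c = ‖A X‖ / frobNorm X}

/-- `κ_A^{(r)} = √(1 + δ_r) / √(1 - δ_r)`. -/
noncomputable def kappa {m n M : ℕ}
    (A : Matrix (Fin m) (Fin n) ℝ →ₗ[ℝ] EuclideanSpace ℝ (Fin M)) (r : ℕ) : ℝ :=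
  Real.sqrt (1 + ric A r) / Real.sqrt (1 - ric A r)

/-- `α_A = ‖A‖_op / √(1 - δ_r)`. -/
noncomputable def alphaConst {m n M : ℕ}
    (A : Matrix (Fin m) (Fin n) ℝ →ₗ[ℝ] EuclideanSpace ℝ (Fin M)) (r : ℕ) : ℝ :=
  opNorm A / Real.sqrt (1 - ric A r)

/-- `t_r = ‖X - Xr‖_F / ‖Xr‖_F`, where `Xr` is the best rank `r` approximation of `X`. -/
noncomputable def tailRatioF {m n : ℕ} (X Xr : Matrix (Fin m) (Fin n) ℝ) : ℝ :=
  frobNorm (X - Xr) / frobNorm Xr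

/-- `s_r = ‖X - Xr‖_* / (√r ‖Xr‖_F)`, where `Xr` is the best rank `r` approximation of `X`. -/
noncomputable def tailRatioNuc {m n : ℕ} (r : ℕ) (X Xr : Matrix (Fin m) (Fin n) ℝ) : ℝ :=
  nuclearNorm (X - Xr) / (Real.sqrt r * frobNorm Xr)

/-- The total noise level; `εA`, `εr`, `εy` bound the relative perturbations of `A` in operator
norm, of `A` in operator norm on rank at most `r`, and of `y = A X`. -/
noncomputable def totalNoise {m n M : ℕ}
    (A : Matrix (Fin m) (Fin n) ℝ →ₗ[ℝ] EuclideanSpace ℝ (Fin M)) (r : ℕ)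
    (X Xr : Matrix (Fin m) (Fin n) ℝ) (εA εr εy : ℝ) : ℝ :=
  ((εr * kappa A r + εA * alphaConst A r * tailRatioF X Xr) /
      (1 - kappa A r * (tailRatioF X Xr + tailRatioNuc r X Xr)) + εy) * ‖A X‖

/-- `X'` is a minimizer of `‖Z‖_p^p` subject to `‖B Z - w‖₂ ≤ η`. -/
def IsSchattenMinimizer {m n M : ℕ} (p : ℝ)
    (B : Matrix (Fin m) (Fin n) ℝ →ₗ[ℝ] EuclideanSpace ℝ (Fin M))
    (w : EuclideanSpace ℝ (Fin M)) (η : ℝ) (X' : Matrix (Fin m) (Fin n) ℝ) : Prop :=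
  ‖B X' - w‖ ≤ η ∧
    ∀ Z : Matrix (Fin m) (Fin n) ℝ, ‖B Z - w‖ ≤ η →
      schattenNorm p X' ^ p ≤ schattenNorm p Z ^ p

/-- The perturbed constant `δ̂_k = (1 + δ_k) (1 + ε)² - 1`. -/
noncomputable def hatDelta {m n M : ℕ}
    (A : Matrix (Fin m) (Fin n) ℝ →ₗ[ℝ] EuclideanSpace ℝ (Fin M)) (k : ℕ) (ε : ℝ) : ℝ :=
  (1 + ric A k) * (1 + ε) ^ 2 - 1

/-- Common denominator of the error constants, with `d₁ = δ̂_{(a+1)r}` and `d₂ = δ̂_{2ar}`. -/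
noncomputable def errDenom (p a d₁ d₂ : ℝ) : ℝ :=
  (1 - d₁) ^ p - a ^ (p / 2 - 1) * (d₁ ^ 2 + d₂ ^ 2) ^ (p / 2)

/-- Noise constant in the Frobenius norm bound. -/
noncomputable def errC1 (p a d₁ d₂ : ℝ) : ℝ :=
  2 ^ p * (1 + a ^ (p / 2 - 1)) * (1 + d₁) ^ (p / 2) / errDenom p a d₁ d₂

/-- Compressibility constant in the Frobenius norm bound. -/
noncomputable def errC2 (p a d₁ d₂ : ℝ) : ℝ :=
  2 * a ^ (p / 2 - 1) *
    (1 + (1 + a ^ (p / 2 - 1)) * (d₁ ^ 2 + d₂ ^ 2) ^ (p / 2) / errDenom p a d₁ d₂)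

/-- Noise constant in the Schatten quasi-norm bound. -/
noncomputable def errC1' (p a d₁ d₂ : ℝ) : ℝ :=
  2 ^ (p + 1) * (1 + a) ^ (1 - p / 2) * (1 + d₁) ^ (p / 2) / errDenom p a d₁ d₂

/-- Compressibility constant in the Schatten quasi-norm bound. -/
noncomputable def errC2' (p a d₁ d₂ : ℝ) : ℝ :=
  2 + 4 * (1 + a) ^ (1 - p / 2) * a ^ (p / 2 - 1) * (d₁ ^ 2 + d₂ ^ 2) ^ (p / 2) /
    errDenom p a d₁ d₂

/-! Put `H = X - Xstar` and `B = A + E`. Three facts about `H` and `B` carry the proof.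

Small image. The noise level `totalNoise` is chosen so that `X` itself is feasible
(`norm_apply_sub_le_totalNoise`). As `Xstar` is feasible too, `‖B H‖` is at most twice that level.

Small tail. For `0 ≤ p ≤ 1` there is a Mirsky-type inequality `∑ |σ_i(T)^p - σ_i(S)^p| ≤ ∑ σ_i(T -
S)^p` (`sum_abs_rpow_singularValues_sub_le`). Applied to `X` and `H`, whose difference is `Xstar`,
and combined with minimality, it bounds the `p`-mass of the singular values of `H` from index `r` on
by the mass before `r` plus `2 ‖X - Xr‖_p^p`. The inequality is obtained by adding rank-one terms
one at a time. Under one such term the singular values interlace (Weyl) and move in total by at most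
its weight (a trace argument on the self-adjoint dilation); for interlaced sequences, concavity of
`t^p` turns the `ℓ¹` bound into one for `p`-th powers.

Restricted isometry. `B` inherits it with the constants `hatDelta` (`perturbed_rip`). Expanding `H`
in its singular vectors gives `B H = ∑ σ_i W_i`, where the vectors `W_i = B (u_i v_iᵀ)` satisfy a
sparse isometry property, so a problem about decreasing sequences remains (`recovery_bounds`). Split
the indices into a head of length `r + k`, `k = a r`, and blocks of length `k`. Near-orthogonality
of disjoint blocks bounds the `ℓ²` norm `h` of the head by `‖B H‖` and the block norms. By
monotonicity each block norm is controlled by the `ℓᵖ` mass of the preceding block, and the small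
tail returns this to `h^p` with a factor `a^(p/2-1)`. The resulting inequality for `h^p` can be
solved because `errDenom` is positive, which is what the bound on `δ_{2ar}` provides. -/

section

open Module InnerProductSpace

/-! ### Concave powers and interlaced sequences. -/

section RpowNumeric

/-- Increments of a concave power decrease. -/
theorem rpow_increment_le {p s l d : ℝ} (hp0 : 0 ≤ p) (hp1 : p ≤ 1) (hs : 0 ≤ s) (hsl : s ≤ l)
    (hd : 0 ≤ d) : (l + d) ^ p + s ^ p ≤ l ^ p + (s + d) ^ p := by
  rcases eq_or_lt_of_le (show s ≤ l + d by linarith) with h | h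
  · have h1 : d = 0 := by linarith
    subst h1; have : s = l := by linarith
    subst this; simp
  · have hc := Real.concaveOn_rpow hp0 hp1
    have hpos : 0 < l + d - s := by linarith
    have hw : (l + d - s) ≠ 0 := hpos.ne'
    -- `l` and `s + d` are convex combinations of `s` and `l + d` with exchanged weights, so the two
    -- concavity inequalities add up to the claim.
    have e1 : 0 ≤ d / (l + d - s) := by positivity
    have e2 : 0 ≤ (l - s) / (l + d - s) := div_nonneg (by linarith) hpos.le
    have e3 : d / (l + d - s) + (l - s) / (l + d - s) = 1 := by field_simp; ring
    have e3' : (l - s) / (l + d - s) + d / (l + d - s) = 1 := by rw [add_comm]; exact e3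
    have h1 := hc.2 (show s ∈ Set.Ici 0 from hs) (show l + d ∈ Set.Ici 0 by
      simp only [Set.mem_Ici]; linarith) e1 e2 e3
    have h2 := hc.2 (show s ∈ Set.Ici 0 from hs) (show l + d ∈ Set.Ici 0 by
      simp only [Set.mem_Ici]; linarith) e2 e1 e3'
    have f1 : d / (l + d - s) * s + (l - s) / (l + d - s) * (l + d) = l := by
      field_simp; ring
    have f2 : (l - s) / (l + d - s) * s + d / (l + d - s) * (l + d) = s + d := by
      field_simp; ring
    simp only [smul_eq_mul, f1, f2] at h1 h2
    have h3 := add_le_add h1 h2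
    have f3 : d / (l + d - s) * s ^ p + (l - s) / (l + d - s) * (l + d) ^ p +
        ((l - s) / (l + d - s) * s ^ p + d / (l + d - s) * (l + d) ^ p) =
        (d / (l + d - s) + (l - s) / (l + d - s)) * (s ^ p + (l + d) ^ p) := by ring
    rw [f3, e3] at h3
    linarith

/-- Induct by removing the largest pair. Interlacing puts the remaining variation `s` below `min (a
0) (b 0)`, and sliding an increment of length `|a 0 - b 0|` from that minimum down to `s` only
enlarges the increment of `t^p`. The second conjunct is carried along to supply the bound on `s`. -/
theorem interlaced_sum_abs_rpow_sub_le {p : ℝ} (hp0 : 0 ≤ p) (hp1 : p ≤ 1) (K : ℕ) :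
    ∀ a b : ℕ → ℝ, (∀ i, 0 ≤ a i) → (∀ i, 0 ≤ b i) → Antitone a → Antitone b →
      (∀ i, a (i + 1) ≤ b i) → (∀ i, b (i + 1) ≤ a i) →
      ∑ i ∈ Finset.range K, |a i ^ p - b i ^ p| ≤ (∑ i ∈ Finset.range K, |a i - b i|) ^ p ∧
        ∑ i ∈ Finset.range K, |a i - b i| ≤ max (a 0) (b 0) := by
  induction K with
  | zero =>
    intro a b ha hb _ _ _ _
    simpa using ⟨Real.rpow_nonneg le_rfl p, Or.inl (ha 0)⟩
  | succ K ih =>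
    intro a b ha hb hAa hAb hab hba
    obtain ⟨h1, h2⟩ := ih (fun i => a (i + 1)) (fun i => b (i + 1)) (fun i => ha _)
      (fun i => hb _) (fun i j hij => hAa (by omega)) (fun i j hij => hAb (by omega))
      (fun i => hab _) (fun i => hba _)
    rw [Finset.sum_range_succ', Finset.sum_range_succ']
    set s := ∑ i ∈ Finset.range K, |a (i + 1) - b (i + 1)| with hs
    have hs0 : 0 ≤ s := Finset.sum_nonneg fun i _ => abs_nonneg _
    have hsl : s ≤ min (a 0) (b 0) := by
      refine h2.trans (max_le (le_min ?_ ?_) (le_min ?_ ?_))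
      · exact hAa (by omega)
      · exact hab 0
      · exact hba 0
      · exact hAb (by omega)
    have hd : |a 0 - b 0| = max (a 0) (b 0) - min (a 0) (b 0) := (max_sub_min_eq_abs' _ _).symm
    have hl0 : 0 ≤ min (a 0) (b 0) := le_min (ha 0) (hb 0)
    have hdp : |a 0 ^ p - b 0 ^ p| = max (a 0) (b 0) ^ p - min (a 0) (b 0) ^ p := by
      rcases le_total (a 0) (b 0) with h | h
      · rw [max_eq_right h, min_eq_left h, abs_sub_comm,
          abs_of_nonneg (sub_nonneg.2 (Real.rpow_le_rpow (ha 0) h hp0))]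
      · rw [max_eq_left h, min_eq_right h,
          abs_of_nonneg (sub_nonneg.2 (Real.rpow_le_rpow (hb 0) h hp0))]
    have key := rpow_increment_le hp0 hp1 hs0 hsl (abs_nonneg (a 0 - b 0))
    have e : min (a 0) (b 0) + |a 0 - b 0| = max (a 0) (b 0) := by rw [hd]; ring
    rw [e] at key
    constructor
    · rw [hdp]; linarith
    · rw [hd]; linarith

end RpowNumeric

/-! ### Min-max principles for eigenvalues and singular values. -/

section CourantFischer

/-- The dimension count behind the min-max arguments: a trial space `G` contains a nonzero vector
satisfying fewer than `dim G` linear constraints. -/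
theorem exists_ne_zero_of_finrank_lt {V G G' : Type*} [AddCommGroup V] [Module ℝ V]
    [AddCommGroup G] [Module ℝ G] [FiniteDimensional ℝ G] [AddCommGroup G'] [Module ℝ G']
    [FiniteDimensional ℝ G'] (ψ : G →ₗ[ℝ] V) (hψ : Function.Injective ψ) (φ : V →ₗ[ℝ] G')
    (h : finrank ℝ G' < finrank ℝ G) : ∃ z : G, ψ z ≠ 0 ∧ φ (ψ z) = 0 := by
  have hk : LinearMap.ker (φ ∘ₗ ψ) ≠ ⊥ := LinearMap.ker_ne_bot_of_finrank_lt h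
  obtain ⟨z, hz, hz0⟩ := (Submodule.ne_bot_iff _).1 hk
  exact ⟨z, fun h0 => hz0 (hψ (by simpa using h0)), by simpa using hz⟩

variable {E : Type*} [NormedAddCommGroup E] [InnerProductSpace ℝ E] [FiniteDimensional ℝ E]
  {F : Type*} [NormedAddCommGroup F] [InnerProductSpace ℝ F] [FiniteDimensional ℝ F] {n : ℕ}

namespace LinearMap.IsSymmetric

variable {T S : E →ₗ[ℝ] E}

theorem inner_apply_eq_sum (hT : T.IsSymmetric) (hn : finrank ℝ E = n) (x : E) :
    ⟪T x, x⟫_ℝ = ∑ i, hT.eigenvalues hn i * (hT.eigenvectorBasis hn).repr x i ^ 2 := by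
  rw [← (hT.eigenvectorBasis hn).repr.inner_map_map, PiLp.inner_apply]
  refine Finset.sum_congr rfl fun i _ => ?_
  rw [hT.eigenvectorBasis_apply_self_apply]
  simp [pow_two]; ring

theorem norm_sq_eq_sum_repr (hT : T.IsSymmetric) (hn : finrank ℝ E = n) (x : E) :
    ‖x‖ ^ 2 = ∑ i, (hT.eigenvectorBasis hn).repr x i ^ 2 := by
  rw [← (hT.eigenvectorBasis hn).repr.norm_map, EuclideanSpace.norm_sq_eq]
  simp

/-- Upper half of the Courant–Fischer principle. -/
theorem exists_map_inner_le (hT : T.IsSymmetric) (hn : finrank ℝ E = n) (i : Fin n) :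
    ∃ φ : E →ₗ[ℝ] (Fin i → ℝ), ∀ x, φ x = 0 → ⟪T x, x⟫_ℝ ≤ hT.eigenvalues hn i * ‖x‖ ^ 2 := by
  refine ⟨LinearMap.pi fun j => (innerₛₗ ℝ (hT.eigenvectorBasis hn (Fin.castLE i.2.le j))),
    fun x hx => ?_⟩
  rw [inner_apply_eq_sum hT hn, norm_sq_eq_sum_repr hT hn, Finset.mul_sum]
  refine Finset.sum_le_sum fun j _ => ?_
  by_cases hj : j < i
  · have h0 := congrFun hx ⟨j, hj⟩
    have : (hT.eigenvectorBasis hn).repr x j = 0 := by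
      rw [OrthonormalBasis.repr_apply_apply]
      simpa using h0
    simp [this]
  · exact mul_le_mul_of_nonneg_right (hT.eigenvalues_antitone hn (not_lt.1 hj)) (sq_nonneg _)

/-- Lower half of the Courant–Fischer principle. -/
theorem exists_map_le_inner (hT : T.IsSymmetric) (hn : finrank ℝ E = n) (i : Fin n) :
    ∃ ψ : (Fin (i + 1) → ℝ) →ₗ[ℝ] E, Function.Injective ψ ∧
      ∀ z, hT.eigenvalues hn i * ‖ψ z‖ ^ 2 ≤ ⟪T (ψ z), ψ z⟫_ℝ := by
  set b := hT.eigenvectorBasis hn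
  have hli : LinearIndependent ℝ (fun j : Fin (i + 1) => b (Fin.castLE i.2 j)) :=
    b.orthonormal.linearIndependent.comp _ (Fin.castLE_injective _)
  refine ⟨Fintype.linearCombination ℝ (fun j : Fin (i + 1) => b (Fin.castLE i.2 j)), ?_, ?_⟩
  · exact LinearIndependent.fintypeLinearCombination_injective hli
  · intro z
    rw [inner_apply_eq_sum hT hn, norm_sq_eq_sum_repr hT hn, Finset.mul_sum]
    refine Finset.sum_le_sum fun j _ => ?_
    by_cases hj : j ≤ i
    · exact mul_le_mul_of_nonneg_right (hT.eigenvalues_antitone hn hj) (sq_nonneg _)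
    · have : b.repr (Fintype.linearCombination ℝ
          (fun j : Fin (i + 1) => b (Fin.castLE i.2 j)) z) j = 0 := by
        rw [OrthonormalBasis.repr_apply_apply, Fintype.linearCombination_apply, inner_sum]
        refine Finset.sum_eq_zero fun l _ => ?_
        rw [inner_smul_right, b.inner_eq_ite, if_neg, mul_zero]
        rintro rfl
        exact hj (by rw [Fin.le_def]; simp; omega)
      simp [b] at this
      simp [b, this]

theorem le_eigenvalues_of_forall_le (hT : T.IsSymmetric) (hn : finrank ℝ E = n) (i : Fin n)
    {c : ℝ} (ψ : (Fin (i + 1) → ℝ) →ₗ[ℝ] E) (hψ : Function.Injective ψ)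
    (h : ∀ z, c * ‖ψ z‖ ^ 2 ≤ ⟪T (ψ z), ψ z⟫_ℝ) : c ≤ hT.eigenvalues hn i := by
  obtain ⟨φ, hφ⟩ := exists_map_inner_le hT hn i
  obtain ⟨z, hz, hz0⟩ := exists_ne_zero_of_finrank_lt ψ hψ φ (by simp)
  have h1 := (h z).trans (hφ _ hz0)
  exact le_of_mul_le_mul_right h1 (by positivity)

theorem eigenvalues_le_of_forall_le (hT : T.IsSymmetric) (hn : finrank ℝ E = n) (i : Fin n)
    {c : ℝ} (φ : E →ₗ[ℝ] (Fin i → ℝ))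
    (h : ∀ x, φ x = 0 → ⟪T x, x⟫_ℝ ≤ c * ‖x‖ ^ 2) : hT.eigenvalues hn i ≤ c := by
  obtain ⟨ψ, hψ, hψ'⟩ := exists_map_le_inner hT hn i
  obtain ⟨z, hz, hz0⟩ := exists_ne_zero_of_finrank_lt ψ hψ φ (by simp)
  have h1 := (hψ' z).trans (h _ hz0)
  exact le_of_mul_le_mul_right h1 (by positivity)

theorem eigenvalues_mono (hT : T.IsSymmetric) (hS : S.IsSymmetric) (hn : finrank ℝ E = n)
    (h : ∀ x, ⟪T x, x⟫_ℝ ≤ ⟪S x, x⟫_ℝ) (i : Fin n) :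
    hT.eigenvalues hn i ≤ hS.eigenvalues hn i := by
  obtain ⟨ψ, hψ, hψ'⟩ := exists_map_le_inner hT hn i
  exact le_eigenvalues_of_forall_le hS hn i ψ hψ fun z => (hψ' z).trans (h _)

/-- Negation reverses the spectrum. The trial space is spanned by the `i + 1` eigenvectors of `T`
from index `i.rev` on. Together with `eigenvalues_rev_le` this gives access to the negative half of
the spectrum of a dilation. -/
theorem neg_eigenvalues_rev_le (hT : T.IsSymmetric) (hT' : (-T).IsSymmetric)
    (hn : finrank ℝ E = n) (i : Fin n) :
    -hT.eigenvalues hn i.rev ≤ hT'.eigenvalues hn i := by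
  set b := hT.eigenvectorBasis hn
  have hi := i.2
  let e : Fin (i + 1) → Fin n := fun j => ⟨i.rev + j, by simp [Fin.rev]; omega⟩
  have he : Function.Injective e := fun j l h => by
    have := congrArg Fin.val h
    simp [e] at this
    exact Fin.ext this
  have hli : LinearIndependent ℝ (fun j : Fin (i + 1) => b (e j)) :=
    b.orthonormal.linearIndependent.comp _ he
  refine le_eigenvalues_of_forall_le hT' hn i
    (Fintype.linearCombination ℝ (fun j : Fin (i + 1) => b (e j)))
    (LinearIndependent.fintypeLinearCombination_injective hli) ?_
  intro z
  rw [LinearMap.neg_apply, inner_neg_left, neg_mul, neg_le_neg_iff,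
    inner_apply_eq_sum hT hn, norm_sq_eq_sum_repr hT hn, Finset.mul_sum]
  refine Finset.sum_le_sum fun j _ => ?_
  by_cases hj : i.rev ≤ j
  · exact mul_le_mul_of_nonneg_right (hT.eigenvalues_antitone hn hj) (sq_nonneg _)
  · have : b.repr (Fintype.linearCombination ℝ (fun j : Fin (i + 1) => b (e j)) z) j = 0 := by
      rw [OrthonormalBasis.repr_apply_apply, Fintype.linearCombination_apply, inner_sum]
      refine Finset.sum_eq_zero fun l _ => ?_
      rw [inner_smul_right, b.inner_eq_ite, if_neg, mul_zero]
      rintro rfl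
      exact hj (by rw [Fin.le_def]; simp [e])
    simp [b] at this
    simp [b, this]

theorem eigenvalues_rev_le (hT : T.IsSymmetric) (hT' : (-T).IsSymmetric)
    (hn : finrank ℝ E = n) (i : Fin n) :
    hT.eigenvalues hn i.rev ≤ -hT'.eigenvalues hn i := by
  have hi := i.2
  rw [le_neg]
  refine eigenvalues_le_of_forall_le hT' hn i
    (LinearMap.pi fun j : Fin i => innerₛₗ ℝ (hT.eigenvectorBasis hn
      ⟨i.rev + 1 + j, by have := j.2; simp [Fin.rev]; omega⟩)) fun x hx => ?_
  rw [LinearMap.neg_apply, inner_neg_left, neg_mul, neg_le_neg_iff,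
    inner_apply_eq_sum hT hn, norm_sq_eq_sum_repr hT hn, Finset.mul_sum]
  refine Finset.sum_le_sum fun j _ => ?_
  by_cases hj : j ≤ i.rev
  · exact mul_le_mul_of_nonneg_right (hT.eigenvalues_antitone hn hj) (sq_nonneg _)
  · have hj' : (i.rev : ℕ) < j := not_le.1 hj
    have hjn := j.2
    have hr : (i.rev : ℕ) = n - (i + 1) := Fin.val_rev i
    have h0 := congrFun hx ⟨j - (i.rev + 1), by omega⟩
    have : (hT.eigenvectorBasis hn).repr x j = 0 := by
      rw [OrthonormalBasis.repr_apply_apply]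
      have e : (⟨i.rev + 1 + (j - (i.rev + 1)), by omega⟩ : Fin n) = j := by
        ext; simp only; omega
      simpa only [LinearMap.pi_apply, e, innerₛₗ_apply_apply, Pi.zero_apply] using h0
    simp [this]

end LinearMap.IsSymmetric

namespace LinearMap

theorem inner_adjoint_comp_self (T : E →ₗ[ℝ] F) (x : E) :
    ⟪(adjoint T ∘ₗ T) x, x⟫_ℝ = ‖T x‖ ^ 2 := by
  rw [comp_apply, adjoint_inner_left, real_inner_self_eq_norm_sq]

theorem exists_map_norm_le_singularValues (T : E →ₗ[ℝ] F) {i : ℕ} (hi : i < finrank ℝ E) :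
    ∃ φ : E →ₗ[ℝ] (Fin i → ℝ), ∀ x, φ x = 0 → ‖T x‖ ≤ T.singularValues i * ‖x‖ := by
  obtain ⟨φ, hφ⟩ := T.isSymmetric_adjoint_comp_self.exists_map_inner_le rfl ⟨i, hi⟩
  refine ⟨φ, fun x hx => ?_⟩
  have h := hφ x hx
  rw [inner_adjoint_comp_self, ← sq_singularValues_of_lt, ← mul_pow] at h
  exact le_of_sq_le_sq h (mul_nonneg (T.singularValues_nonneg i) (norm_nonneg x))

theorem exists_map_singularValues_le_norm (T : E →ₗ[ℝ] F) {i : ℕ} (hi : i < finrank ℝ E) :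
    ∃ ψ : (Fin (i + 1) → ℝ) →ₗ[ℝ] E, Function.Injective ψ ∧
      ∀ z, T.singularValues i * ‖ψ z‖ ≤ ‖T (ψ z)‖ := by
  obtain ⟨ψ, hψ, h⟩ := T.isSymmetric_adjoint_comp_self.exists_map_le_inner rfl ⟨i, hi⟩
  refine ⟨ψ, hψ, fun z => ?_⟩
  have h := h z
  rw [inner_adjoint_comp_self, ← sq_singularValues_of_lt, ← mul_pow] at h
  exact le_of_sq_le_sq h (norm_nonneg _)

/-- Weyl's inequality for a low rank perturbation. -/
theorem singularValues_add_finrank_range_le (S K : E →ₗ[ℝ] F) {j : ℕ}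
    (hj : finrank ℝ (range K) ≤ j) (i : ℕ) :
    (S + K).singularValues (i + j) ≤ S.singularValues i := by
  by_cases hi : i + j < finrank ℝ E
  · obtain ⟨ψ, hψ, h⟩ := (S + K).exists_map_singularValues_le_norm hi
    obtain ⟨φ, hφ⟩ := S.exists_map_norm_le_singularValues (show i < finrank ℝ E by omega)
    -- There are at most `i + j` constraints on a trial space of dimension `i + j + 1`; on the
    -- kernel of `K` only `S` is seen.
    obtain ⟨z, hz, hz0⟩ := exists_ne_zero_of_finrank_lt ψ hψ (φ.prod K.rangeRestrict)
      (by rw [finrank_prod, finrank_fin_fun, finrank_fin_fun]; omega)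
    have h1 : φ (ψ z) = 0 := congrArg Prod.fst hz0
    have h2 : K (ψ z) = 0 := congrArg (Subtype.val ∘ Prod.snd) hz0
    have h3 := h z
    rw [add_apply, h2, add_zero] at h3
    exact le_of_mul_le_mul_right (h3.trans (hφ _ h1)) (norm_pos_iff.2 hz)
  · rw [singularValues_of_finrank_le _ (not_lt.1 hi)]
    exact S.singularValues_nonneg i

end LinearMap

end CourantFischer

/-! ### Singular vectors, the self-adjoint dilation and Mirsky-type inequalities. -/

section RankOne

variable {E : Type*} [NormedAddCommGroup E] [InnerProductSpace ℝ E]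
  {F : Type*} [NormedAddCommGroup F] [InnerProductSpace ℝ F]

/-- The operator `x ↦ c ⟪v, x⟫ u`. -/
noncomputable def rankOneMap (c : ℝ) (u : F) (v : E) : E →ₗ[ℝ] F :=
  (c • innerₛₗ ℝ v).smulRight u

theorem rankOneMap_apply (c : ℝ) (u : F) (v x : E) :
    rankOneMap c u v x = (c * ⟪v, x⟫_ℝ) • u := by
  simp [rankOneMap]

theorem finrank_range_rankOneMap_le (c : ℝ) (u : F) (v : E) :
    finrank ℝ (LinearMap.range (rankOneMap c u v)) ≤ 1 := by
  have h : LinearMap.range (rankOneMap c u v) ≤ ℝ ∙ u := by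
    rintro _ ⟨x, rfl⟩
    rw [rankOneMap_apply]
    exact Submodule.smul_mem _ _ (Submodule.mem_span_singleton_self u)
  exact (Submodule.finrank_mono h).trans ((finrank_span_le_card {u}).trans (by simp))

theorem isSymmetric_rankOneMap (c : ℝ) (w : E) : (rankOneMap c w w).IsSymmetric := by
  intro x y
  simp only [rankOneMap_apply, inner_smul_left, inner_smul_right, RCLike.conj_to_real]
  rw [real_inner_comm x w]
  ring

variable [FiniteDimensional ℝ E] [FiniteDimensional ℝ F]

/-- Singular value decomposition. -/
theorem LinearMap.exists_singular_vectors (T : E →ₗ[ℝ] F) :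
    ∃ (u : ℕ → F) (v : ℕ → E),
      Orthonormal ℝ (fun i : Fin (finrank ℝ (range T)) => u i) ∧
      Orthonormal ℝ (fun i : Fin (finrank ℝ (range T)) => v i) ∧
      (∀ i < finrank ℝ (range T), T (v i) = T.singularValues i • u i) ∧
      ∀ x, T x = ∑ i ∈ Finset.range (finrank ℝ (range T)),
        (T.singularValues i * ⟪v i, x⟫_ℝ) • u i := by
  set ρ := finrank ℝ (range T) with hρ
  have hρn : ρ ≤ finrank ℝ E := T.finrank_range_le
  set b := T.isSymmetric_adjoint_comp_self.eigenvectorBasis rfl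
  have hTb : ∀ i j, ⟪T (b i), T (b j)⟫_ℝ = if i = j then T.singularValues i ^ 2 else 0 := by
    intro i j
    rw [← adjoint_inner_left, ← comp_apply,
      T.isSymmetric_adjoint_comp_self.apply_eigenvectorBasis rfl, inner_smul_left,
      b.inner_eq_ite, T.sq_singularValues_fin rfl]
    split_ifs <;> simp
  let v : ℕ → E := fun i => if h : i < finrank ℝ E then b ⟨i, h⟩ else 0
  let u : ℕ → F := fun i => (T.singularValues i)⁻¹ • T (v i)
  have hv : ∀ i (h : i < finrank ℝ E), v i = b ⟨i, h⟩ := fun i h => dif_pos h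
  have hpos : ∀ i < ρ, T.singularValues i ≠ 0 := fun i hi =>
    ((T.singularValues_pos_iff_lt_finrank_range).2 hi).ne'
  have hTv : ∀ i < ρ, T (v i) = T.singularValues i • u i := fun i hi => by
    simp only [u, smul_smul, mul_inv_cancel₀ (hpos i hi), one_smul]
  refine ⟨u, v, ?_, ?_, hTv, ?_⟩
  · rw [orthonormal_iff_ite]
    intro i j
    have hi := hpos i i.2
    simp only [u, inner_smul_left, inner_smul_right, hv _ (i.2.trans_le hρn),
      hv _ (j.2.trans_le hρn), hTb, Fin.mk.injEq, Fin.val_inj, RCLike.conj_to_real]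
    split_ifs with h
    · subst h; field_simp
    · simp
  · rw [orthonormal_iff_ite]
    intro i j
    simp only [hv _ (i.2.trans_le hρn), hv _ (j.2.trans_le hρn), b.inner_eq_ite, Fin.mk.injEq,
      Fin.val_inj]
  · intro x
    have hz : ∀ i (h : i < finrank ℝ E), ρ ≤ i → T (b ⟨i, h⟩) = 0 := by
      intro i h hi
      have h0 : T.singularValues i = 0 :=
        T.singularValues_eq_zero_iff_le_finrank_range.2 hi
      have h1 := hTb ⟨i, h⟩ ⟨i, h⟩
      simpa [h0] using h1
    conv_lhs => rw [← b.sum_repr' x, map_sum]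
    simp only [map_smul]
    have e : ∀ i : Fin (finrank ℝ E), ⟪b i, x⟫_ℝ • T (b i) =
        (fun i : ℕ => ⟪v i, x⟫_ℝ • T (v i)) i := fun i => by
      simp only [hv _ i.2]
    rw [Finset.sum_congr rfl fun i _ => e i,
      Fin.sum_univ_eq_sum_range (fun i : ℕ => ⟪v i, x⟫_ℝ • T (v i)),
      ← Finset.sum_subset (Finset.range_mono hρn)]
    · refine Finset.sum_congr rfl fun i hi => ?_
      rw [hTv i (Finset.mem_range.1 hi), smul_smul, mul_comm]
    · intro i hi hi'
      rw [Finset.mem_range] at hi hi'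
      rw [hv i hi, hz i hi (not_lt.1 hi'), smul_zero]

/-- The self-adjoint dilation `(x, y) ↦ (T† y, T x)`. -/
noncomputable def dilation (T : E →ₗ[ℝ] F) : WithLp 2 (E × F) →ₗ[ℝ] WithLp 2 (E × F) :=
  (WithLp.linearEquiv 2 ℝ (E × F)).symm.toLinearMap ∘ₗ
    ((LinearMap.adjoint T ∘ₗ LinearMap.snd ℝ E F).prod (T ∘ₗ LinearMap.fst ℝ E F)) ∘ₗ
      (WithLp.linearEquiv 2 ℝ (E × F)).toLinearMap

theorem dilation_apply (T : E →ₗ[ℝ] F) (w : WithLp 2 (E × F)) :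
    dilation T w = WithLp.toLp 2 (LinearMap.adjoint T w.snd, T w.fst) := rfl

theorem dilation_neg (T : E →ₗ[ℝ] F) : dilation (-T) = -dilation T := by
  ext1 w
  rw [LinearMap.neg_apply, dilation_apply, dilation_apply, map_neg]
  rfl

theorem isSymmetric_dilation (T : E →ₗ[ℝ] F) : (dilation T).IsSymmetric := by
  intro w w'
  simp only [dilation_apply, WithLp.prod_inner_apply, LinearMap.adjoint_inner_left,
    LinearMap.adjoint_inner_right]
  exact add_comm _ _

theorem inner_dilation_self (T : E →ₗ[ℝ] F) (w : WithLp 2 (E × F)) :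
    ⟪dilation T w, w⟫_ℝ = 2 * ⟪T w.fst, w.snd⟫_ℝ := by
  simp only [dilation_apply, WithLp.prod_inner_apply, LinearMap.adjoint_inner_left]
  rw [real_inner_comm]
  simp only [WithLp.fst, WithLp.snd]
  ring

theorem finrank_prodL2 {n m : ℕ} (hE : finrank ℝ E = n) (hF : finrank ℝ F = m) :
    finrank ℝ (WithLp 2 (E × F)) = n + m := by
  rw [(WithLp.linearEquiv 2 ℝ (E × F)).finrank_eq, finrank_prod, hE, hF]

/-- Constraining only the first component `x` suffices: then `2 ⟪T x, y⟫ ≤ 2 σ_i ‖x‖ ‖y‖ ≤ σ_i (‖x‖²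
+ ‖y‖²)`. -/
theorem eigenvalues_dilation_le (T : E →ₗ[ℝ] F) {N : ℕ}
    (hN : finrank ℝ (WithLp 2 (E × F)) = N) (i : Fin N) (hi : (i : ℕ) < finrank ℝ E) :
    (isSymmetric_dilation T).eigenvalues hN i ≤ T.singularValues i := by
  obtain ⟨φ, hφ⟩ := T.exists_map_norm_le_singularValues hi
  refine LinearMap.IsSymmetric.eigenvalues_le_of_forall_le _ hN i
    (φ ∘ₗ LinearMap.fst ℝ E F ∘ₗ (WithLp.linearEquiv 2 ℝ (E × F)).toLinearMap) fun w hw => ?_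
  have h := hφ w.fst hw
  rw [inner_dilation_self, WithLp.prod_norm_sq_eq_of_L2]
  have h1 := real_inner_le_norm (T w.fst) w.snd
  have h2 := mul_le_mul_of_nonneg_right h (norm_nonneg w.snd)
  have h3 := mul_nonneg (T.singularValues_nonneg i) (sq_nonneg (‖w.fst‖ - ‖w.snd‖))
  nlinarith

/-- The trial space consists of the pairs `(∑ z_j v_j, ∑ z_j u_j)` with `j ≤ i`, where the form
equals `2 ∑ σ_j z_j²`. Positivity of `σ_i` guarantees that these singular vectors exist. -/
theorem singularValues_le_eigenvalues_dilation (T : E →ₗ[ℝ] F) {N : ℕ}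
    (hN : finrank ℝ (WithLp 2 (E × F)) = N) (i : Fin N) (hi : 0 < T.singularValues i) :
    T.singularValues i ≤ (isSymmetric_dilation T).eigenvalues hN i := by
  have hi' : (i : ℕ) + 1 ≤ finrank ℝ (LinearMap.range T) :=
    T.singularValues_pos_iff_lt_finrank_range.1 hi
  obtain ⟨u, v, hu, hv, hTv, -⟩ := T.exists_singular_vectors
  have hu' := hu.comp _ (Fin.castLE_injective hi')
  have hv' := hv.comp _ (Fin.castLE_injective hi')
  have hx := hv'.linearIndependent.fintypeLinearCombination_injective
  set ψ₁ := Fintype.linearCombination ℝ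
    ((fun i : Fin (finrank ℝ (LinearMap.range T)) => v i) ∘ Fin.castLE hi') with hψ₁
  set ψ₂ := Fintype.linearCombination ℝ
    ((fun i : Fin (finrank ℝ (LinearMap.range T)) => u i) ∘ Fin.castLE hi') with hψ₂
  refine LinearMap.IsSymmetric.le_eigenvalues_of_forall_le _ hN i
    ((WithLp.linearEquiv 2 ℝ (E × F)).symm.toLinearMap ∘ₗ ψ₁.prod ψ₂) ?_ fun z => ?_
  · intro z z' h
    have h' := (WithLp.linearEquiv 2 ℝ (E × F)).symm.injective h
    exact hx (congrArg Prod.fst h')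
  · rw [inner_dilation_self, WithLp.prod_norm_sq_eq_of_L2]
    change _ * (‖ψ₁ z‖ ^ 2 + ‖ψ₂ z‖ ^ 2) ≤ 2 * ⟪T (ψ₁ z), ψ₂ z⟫_ℝ
    have e1 : ‖ψ₁ z‖ ^ 2 = ∑ j, z j ^ 2 := by
      rw [← real_inner_self_eq_norm_sq, hψ₁, Fintype.linearCombination_apply, hv'.inner_sum]
      simp [pow_two]
    have e2 : ‖ψ₂ z‖ ^ 2 = ∑ j, z j ^ 2 := by
      rw [← real_inner_self_eq_norm_sq, hψ₂, Fintype.linearCombination_apply, hu'.inner_sum]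
      simp [pow_two]
    have e3 : ⟪T (ψ₁ z), ψ₂ z⟫_ℝ = ∑ j : Fin (i + 1), T.singularValues j * z j ^ 2 := by
      have : T (ψ₁ z) = ∑ j : Fin (i + 1), (T.singularValues j * z j) •
          ((fun i : Fin (finrank ℝ (LinearMap.range T)) => u i) ∘ Fin.castLE hi') j := by
        rw [hψ₁, Fintype.linearCombination_apply, map_sum]
        refine Finset.sum_congr rfl fun j _ => ?_
        simp only [map_smul, Function.comp_apply, Fin.val_castLE]
        rw [hTv j (by have := j.2; omega), smul_smul, mul_comm]
      rw [this, hψ₂, Fintype.linearCombination_apply, hu'.inner_sum]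
      refine Finset.sum_congr rfl fun j _ => ?_
      simp [pow_two, mul_assoc]
    rw [e1, e2, e3, ← two_mul, mul_left_comm, Finset.mul_sum]
    refine mul_le_mul_of_nonneg_left (Finset.sum_le_sum fun j _ => ?_) zero_le_two
    exact mul_le_mul_of_nonneg_right (T.singularValues_antitone (by have := j.2; omega))
      (sq_nonneg _)

theorem singularValues_neg (T : E →ₗ[ℝ] F) : (-T).singularValues = T.singularValues := by
  ext i
  by_cases hi : i < finrank ℝ E
  · rw [LinearMap.singularValues_of_lt _ rfl hi, LinearMap.singularValues_of_lt _ rfl hi]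
    congr 2
    ext x
    simp
  · rw [LinearMap.singularValues_of_finrank_le _ (not_lt.1 hi),
      LinearMap.singularValues_of_finrank_le _ (not_lt.1 hi)]

theorem trace_rankOneMap (c : ℝ) (w : E) :
    LinearMap.trace ℝ E (rankOneMap c w w) = c * ‖w‖ ^ 2 := by
  have b := stdOrthonormalBasis ℝ E
  rw [LinearMap.trace_eq_sum_inner _ b, ← b.sum_sq_norm_inner_left w, Finset.mul_sum]
  refine Finset.sum_congr rfl fun i _ => ?_
  rw [rankOneMap_apply, inner_smul_right, real_inner_comm, Real.norm_eq_abs, sq_abs]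
  ring

/-- Mirsky's inequality in the trace norm for a rank one perturbation. -/
theorem sum_abs_singularValues_add_rankOneMap_sub_le (D : E →ₗ[ℝ] F) {c : ℝ} (hc : 0 ≤ c)
    {u : F} {v : E} (hu : ‖u‖ = 1) (hv : ‖v‖ = 1) {K : ℕ} (hKE : K ≤ finrank ℝ E)
    (hKF : K ≤ finrank ℝ F) :
    ∑ i ∈ Finset.range K,
      |(D + rankOneMap c u v).singularValues i - D.singularValues i| ≤ c := by
  set R := rankOneMap c u v with hR
  set w : WithLp 2 (E × F) := WithLp.toLp 2 (v, u) with hw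
  -- The form of `P` is `c/2 (⟪v, x⟫ + ⟪u, y⟫)²`: nonnegative, and larger than the form `2 c ⟪v, x⟫
  -- ⟪u, y⟫` of `dilation R` by a square. So `dilation D + P` dominates the dilations of both `D`
  -- and `D + R`, while `P` has trace only `c`.
  set P := rankOneMap (c / 2) w w with hP
  have hN := finrank_prodL2 (E := E) (F := F) rfl rfl
  set N := finrank ℝ E + finrank ℝ F with hNdef
  have hU : (dilation D + P).IsSymmetric :=
    (isSymmetric_dilation D).add (isSymmetric_rankOneMap _ _)
  have hPin : ∀ x : WithLp 2 (E × F), ⟪P x, x⟫_ℝ = c / 2 * (⟪v, x.fst⟫_ℝ + ⟪u, x.snd⟫_ℝ) ^ 2 := by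
    intro x
    rw [hP, rankOneMap_apply, inner_smul_left, RCLike.conj_to_real]
    simp only [hw, WithLp.prod_inner_apply, WithLp.fst, WithLp.snd]
    ring
  set U := hU.eigenvalues hN
  set L := (isSymmetric_dilation D).eigenvalues hN
  set L' := (isSymmetric_dilation (D + R)).eigenvalues hN
  have hLU : ∀ j, L j ≤ U j := fun j => by
    refine LinearMap.IsSymmetric.eigenvalues_mono _ _ hN (fun x => ?_) j
    rw [LinearMap.add_apply, inner_add_left, hPin]
    have : 0 ≤ c / 2 * (⟪v, x.fst⟫_ℝ + ⟪u, x.snd⟫_ℝ) ^ 2 := by positivity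
    linarith
  have hL'U : ∀ j, L' j ≤ U j := fun j => by
    refine LinearMap.IsSymmetric.eigenvalues_mono _ _ hN (fun x => ?_) j
    rw [LinearMap.add_apply, inner_add_left, hPin, inner_dilation_self, inner_dilation_self,
      LinearMap.add_apply, inner_add_left, hR, rankOneMap_apply, inner_smul_left,
      RCLike.conj_to_real]
    have := mul_nonneg hc (sq_nonneg (⟪v, x.fst⟫_ℝ - ⟪u, x.snd⟫_ℝ))
    nlinarith
  have htr : ∑ j, (U j - L j) = c := by
    have h1 : LinearMap.trace ℝ _ (dilation D + P) = ∑ j, U j := hU.trace_eq_sum_eigenvalues hN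
    have h2 : LinearMap.trace ℝ _ (dilation D) = ∑ j, L j :=
      (isSymmetric_dilation D).trace_eq_sum_eigenvalues hN
    have h3 : LinearMap.trace ℝ _ P = c / 2 * (‖v‖ ^ 2 + ‖u‖ ^ 2) := by
      rw [hP, trace_rankOneMap, WithLp.prod_norm_sq_eq_of_L2]
      rfl
    rw [map_add, h2, h3, hu, hv] at h1
    rw [Finset.sum_sub_distrib, ← h1]
    ring
  have hrev_le : ∀ (T : E →ₗ[ℝ] F) (j : Fin N) , 0 < T.singularValues j →
      (isSymmetric_dilation T).eigenvalues hN j.rev ≤ -T.singularValues j := by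
    intro T j hj
    have h' : (-dilation T).IsSymmetric := dilation_neg T ▸ isSymmetric_dilation (-T)
    refine ((isSymmetric_dilation T).eigenvalues_rev_le h' hN j).trans (neg_le_neg ?_)
    have h1 := singularValues_le_eigenvalues_dilation (-T) hN j (by rwa [singularValues_neg])
    rw [singularValues_neg] at h1
    have e : h'.eigenvalues hN j = (isSymmetric_dilation (-T)).eigenvalues hN j := by
      congr 1; exact (dilation_neg T).symm
    rwa [e]
  have hle_rev : ∀ (T : E →ₗ[ℝ] F) (j : Fin N), (j : ℕ) < finrank ℝ E →
      -T.singularValues j ≤ (isSymmetric_dilation T).eigenvalues hN j.rev := by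
    intro T j hj
    have h' : (-dilation T).IsSymmetric := dilation_neg T ▸ isSymmetric_dilation (-T)
    have h0 := (isSymmetric_dilation T).neg_eigenvalues_rev_le h' hN j
    have h1 := eigenvalues_dilation_le (-T) hN j hj
    rw [singularValues_neg] at h1
    have e : h'.eigenvalues hN j = (isSymmetric_dilation (-T)).eigenvalues hN j := by
      congr 1; exact (dilation_neg T).symm
    rw [e] at h0
    linarith
  -- An increase of the singular value is charged to the eigenvalue gap at `j`, a decrease to the
  -- gap at the mirrored index.
  have hpt : ∀ j : Fin N, (j : ℕ) < K →
      |(D + R).singularValues j - D.singularValues j| ≤ (U j - L j) + (U j.rev - L j.rev) := by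
    intro j hj
    have hjE : (j : ℕ) < finrank ℝ E := by omega
    have g1 := sub_nonneg.2 (hLU j)
    have g2 := sub_nonneg.2 (hLU j.rev)
    rcases le_total (D.singularValues j) ((D + R).singularValues j) with h | h
    · rw [abs_of_nonneg (sub_nonneg.2 h)]
      rcases h.eq_or_lt with h | h
      · rw [h]; linarith
      · have h1 := singularValues_le_eigenvalues_dilation (D + R) hN j
          ((D.singularValues_nonneg j).trans_lt h)
        have h2 := eigenvalues_dilation_le D hN j hjE
        have h3 := hL'U j
        linarith
    · rw [abs_of_nonpos (sub_nonpos.2 h)]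
      rcases h.eq_or_lt with h | h
      · rw [h]; linarith
      · have h1 := hrev_le D j (((D + R).singularValues_nonneg j).trans_lt h)
        have h2 := hle_rev (D + R) j hjE
        have h3 := hL'U j.rev
        linarith
  have hKN : K ≤ N := by omega
  have e1 : ∑ i ∈ Finset.range K, |(D + R).singularValues i - D.singularValues i| =
      ∑ j ∈ Finset.univ.filter (fun j : Fin N => (j : ℕ) < K),
        |(D + R).singularValues j - D.singularValues j| := by
    rw [Finset.sum_filter, Fin.sum_univ_eq_sum_range (fun i => if i < K then
      |(D + R).singularValues i - D.singularValues i| else 0), ← Finset.sum_filter]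
    congr 1
    ext i; simp; omega
  rw [e1]
  refine (Finset.sum_le_sum fun j hj => hpt j (Finset.mem_filter.1 hj).2).trans ?_
  rw [Finset.sum_add_distrib, ← htr]
  have e2 : ∑ j ∈ Finset.univ.filter (fun j : Fin N => (j : ℕ) < K), (U j.rev - L j.rev) =
      ∑ j ∈ Finset.univ.filter (fun j : Fin N => (j.rev : ℕ) < K), (U j - L j) := by
    refine Finset.sum_bij (fun j _ => j.rev) ?_ ?_ ?_ ?_
    · intro j hj; simpa only [Finset.mem_filter, Finset.mem_univ, Fin.rev_rev] using hj
    · intro a _ b _ h; exact Fin.rev_injective h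
    · intro b hb; exact ⟨b.rev, by simpa only [Finset.mem_filter, Finset.mem_univ, Fin.rev_rev] using hb,
        Fin.rev_rev b⟩
    · intro j _; rfl
  -- As `2 K ≤ N`, the indices below `K` and their mirror images are disjoint, so each gap is
  -- charged at most once.
  rw [e2, ← Finset.sum_union]
  · exact Finset.sum_le_sum_of_subset_of_nonneg (Finset.subset_univ _)
      fun j _ _ => sub_nonneg.2 (hLU j)
  · rw [Finset.disjoint_filter]
    intro j _ h1 h2
    rw [Fin.val_rev] at h2
    omega

/-- Weyl's inequality, used for the rank-one term and for its negative, gives the interlacing; the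
case `p = 1` gives the total variation. -/
theorem sum_abs_rpow_singularValues_add_rankOneMap_sub_le {p : ℝ} (hp0 : 0 ≤ p) (hp1 : p ≤ 1)
    (D : E →ₗ[ℝ] F) {c : ℝ} (hc : 0 ≤ c)
    {u : F} {v : E} (hu : ‖u‖ = 1) (hv : ‖v‖ = 1) {K : ℕ} (hKE : K ≤ finrank ℝ E)
    (hKF : K ≤ finrank ℝ F) :
    ∑ i ∈ Finset.range K,
      |(D + rankOneMap c u v).singularValues i ^ p - D.singularValues i ^ p| ≤ c ^ p := by
  have hR := finrank_range_rankOneMap_le c u v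
  have hR' : finrank ℝ (LinearMap.range (-rankOneMap c u v)) ≤ 1 := by rwa [LinearMap.range_neg]
  refine ((interlaced_sum_abs_rpow_sub_le hp0 hp1 K _ _
    (D + rankOneMap c u v).singularValues_nonneg D.singularValues_nonneg
    (D + rankOneMap c u v).singularValues_antitone D.singularValues_antitone
    (fun i => D.singularValues_add_finrank_range_le _ hR i) (fun i => ?_)).1).trans ?_
  · have h := (D + rankOneMap c u v).singularValues_add_finrank_range_le _ hR' i
    rwa [add_neg_cancel_right] at h
  · exact Real.rpow_le_rpow (Finset.sum_nonneg fun i _ => abs_nonneg _)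
      (sum_abs_singularValues_add_rankOneMap_sub_le D hc hu hv hKE hKF) hp0

/-- Concave power version of Mirsky's inequality. -/
theorem sum_abs_rpow_singularValues_sub_le {p : ℝ} (hp0 : 0 ≤ p) (hp1 : p ≤ 1)
    (T S : E →ₗ[ℝ] F) {K : ℕ} (hKE : K ≤ finrank ℝ E) (hKF : K ≤ finrank ℝ F) :
    ∑ i ∈ Finset.range K, |T.singularValues i ^ p - S.singularValues i ^ p| ≤
      ∑ i ∈ Finset.range (finrank ℝ (LinearMap.range (T - S))), (T - S).singularValues i ^ p := by
  obtain ⟨u, v, hu, hv, -, hsum⟩ := (T - S).exists_singular_vectors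
  set ρ := finrank ℝ (LinearMap.range (T - S))
  set s := (T - S).singularValues
  -- Pass from `S` to `T` through the partial sums of the singular value decomposition of `T - S`;
  -- the `j`-th step costs at most `s j ^ p`.
  have key : ∀ k ≤ ρ, ∑ i ∈ Finset.range K,
      |(S + ∑ j ∈ Finset.range k, rankOneMap (s j) (u j) (v j)).singularValues i ^ p -
        S.singularValues i ^ p| ≤ ∑ j ∈ Finset.range k, s j ^ p := by
    intro k
    induction k with
    | zero => simp
    | succ k ih =>
      intro hk
      have h1 := ih (by omega)
      have h2 := sum_abs_rpow_singularValues_add_rankOneMap_sub_le hp0 hp1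
        (S + ∑ j ∈ Finset.range k, rankOneMap (s j) (u j) (v j))
        ((T - S).singularValues_nonneg k) (hu.1 ⟨k, hk⟩) (hv.1 ⟨k, hk⟩) hKE hKF
      rw [add_assoc, ← Finset.sum_range_succ (fun j => rankOneMap (s j) (u j) (v j))] at h2
      rw [Finset.sum_range_succ (fun j => s j ^ p)]
      refine le_trans ?_ (add_le_add h1 h2)
      rw [← Finset.sum_add_distrib]
      refine Finset.sum_le_sum fun i _ => ?_
      rw [add_comm |_ - S.singularValues i ^ p|]
      exact abs_sub_le _ _ _
  have e : S + ∑ j ∈ Finset.range ρ, rankOneMap (s j) (u j) (v j) = T := by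
    ext x
    have := hsum x
    simp only [LinearMap.add_apply, LinearMap.sum_apply, rankOneMap_apply]
    rw [← this]; simp
  have h := key ρ le_rfl
  rwa [e] at h

end RankOne

/-! ### Comparing `ℓ²` and `ℓᵖ` sizes of blocks of a decreasing sequence. -/

section BlockEstimates

theorem rpow_sum_le_sum_rpow {ι : Type*} {p : ℝ} (hp0 : 0 < p) (hp1 : p ≤ 1) (S : Finset ι)
    (x : ι → ℝ) (hx : ∀ i, 0 ≤ x i) : (∑ i ∈ S, x i) ^ p ≤ ∑ i ∈ S, x i ^ p := by
  classical
  induction S using Finset.induction_on with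
  | empty => simp [Real.zero_rpow hp0.ne']
  | insert i S hi ih =>
    rw [Finset.sum_insert hi, Finset.sum_insert hi]
    exact (Real.rpow_add_le_add_rpow (hx i) (Finset.sum_nonneg fun j _ => hx j) hp0.le hp1).trans
      (by gcongr)

/-- A block of a decreasing sequence is controlled in `ℓ²` by the preceding block in `ℓᵖ`. -/
theorem sum_sq_block_rpow_le {p : ℝ} (hp : 0 < p) {s : ℕ → ℝ} (hs0 : ∀ i, 0 ≤ s i)
    (hs : Antitone s) {k : ℕ} (hk : 0 < k) (e : ℕ) :
    (∑ i ∈ Finset.Ico (e + k) (e + 2 * k), s i ^ 2) ^ (p / 2) ≤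
      (k : ℝ) ^ (p / 2 - 1) * ∑ i ∈ Finset.Ico e (e + k), s i ^ p := by
  have hk' : (0 : ℝ) < k := by exact_mod_cast hk
  set σ := ∑ i ∈ Finset.Ico e (e + k), s i ^ p with hσ
  have hσ0 : 0 ≤ σ := Finset.sum_nonneg fun i _ => Real.rpow_nonneg (hs0 i) p
  -- Each entry of the later block lies below every entry of the earlier one, hence below their mean
  -- in `p`-th powers.
  have hmean : ∀ i, e + k ≤ i → s i ^ p ≤ σ / k := by
    intro i hi
    rw [le_div_iff₀ hk', mul_comm, hσ]
    have : ∑ _j ∈ Finset.Ico e (e + k), s i ^ p ≤ ∑ j ∈ Finset.Ico e (e + k), s j ^ p := by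
      refine Finset.sum_le_sum fun j hj => ?_
      rw [Finset.mem_Ico] at hj
      exact Real.rpow_le_rpow (hs0 i) (hs (by omega)) hp.le
    simpa using this
  have hsq : ∀ i, e + k ≤ i → s i ^ 2 ≤ (σ / k) ^ (2 / p) := by
    intro i hi
    have h := Real.rpow_le_rpow (Real.rpow_nonneg (hs0 i) p) (hmean i hi)
      (show 0 ≤ 2 / p by positivity)
    rwa [← Real.rpow_mul (hs0 i), mul_div_cancel₀ _ hp.ne', Real.rpow_two] at h
  have hsum : ∑ i ∈ Finset.Ico (e + k) (e + 2 * k), s i ^ 2 ≤ k * (σ / k) ^ (2 / p) := by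
    refine (Finset.sum_le_card_nsmul _ _ _ fun i hi => hsq i (Finset.mem_Ico.1 hi).1).trans ?_
    rw [Nat.card_Ico, nsmul_eq_mul, show e + 2 * k - (e + k) = k by omega]
  refine (Real.rpow_le_rpow (Finset.sum_nonneg fun i _ => sq_nonneg _) hsum
    (by positivity)).trans ?_
  rw [Real.mul_rpow hk'.le (by positivity), ← Real.rpow_mul (by positivity),
    show 2 / p * (p / 2) = 1 by field_simp, Real.rpow_one, Real.rpow_sub_one hk'.ne']
  apply le_of_eq; ring

theorem sum_sq_blocks_rpow_le {p : ℝ} (hp : 0 < p) {s : ℕ → ℝ} (hs0 : ∀ i, 0 ≤ s i)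
    (hs : Antitone s) {k : ℕ} (hk : 0 < k) (e L : ℕ) :
    ∑ j ∈ Finset.range L,
        (∑ i ∈ Finset.Ico (e + (j + 1) * k) (e + (j + 2) * k), s i ^ 2) ^ (p / 2) ≤
      (k : ℝ) ^ (p / 2 - 1) * ∑ i ∈ Finset.Ico e (e + L * k), s i ^ p := by
  induction L with
  | zero => simp
  | succ L ih =>
    rw [Finset.sum_range_succ, ← Finset.sum_Ico_consecutive _ (show e ≤ e + L * k by omega)
      (show e + L * k ≤ e + (L + 1) * k by rw [Nat.succ_mul]; omega), mul_add]
    refine add_le_add ih ?_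
    have h := sum_sq_block_rpow_le hp hs0 hs hk (e + L * k)
    rwa [show e + L * k + k = e + (L + 1) * k by ring,
      show e + L * k + 2 * k = e + (L + 2) * k by ring] at h

theorem sum_rpow_le_card_rpow_mul {p : ℝ} (hp0 : 0 < p) (hp1 : p ≤ 1) {s : ℕ → ℝ}
    (hs0 : ∀ i, 0 ≤ s i) {r : ℕ} (hr : 0 < r) :
    ∑ i ∈ Finset.range r, s i ^ p ≤
      (r : ℝ) ^ (1 - p / 2) * (∑ i ∈ Finset.range r, s i ^ 2) ^ (p / 2) := by
  have hr' : (0 : ℝ) < r := by exact_mod_cast hr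
  have h := Real.rpow_sum_le_const_mul_sum_rpow_of_nonneg (Finset.range r)
    (show 1 ≤ 2 / p by rw [le_div_iff₀ hp0]; linarith)
    (f := fun i => s i ^ p) (fun i _ => Real.rpow_nonneg (hs0 i) p)
  have e : ∀ i, (s i ^ p) ^ (2 / p) = s i ^ 2 := fun i => by
    rw [← Real.rpow_mul (hs0 i), mul_div_cancel₀ _ hp0.ne', Real.rpow_two]
  simp only [e, Finset.card_range] at h
  have hσ0 : 0 ≤ ∑ i ∈ Finset.range r, s i ^ p :=
    Finset.sum_nonneg fun i _ => Real.rpow_nonneg (hs0 i) p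
  have h2 := Real.rpow_le_rpow (Real.rpow_nonneg hσ0 _) h (show 0 ≤ p / 2 by positivity)
  rw [← Real.rpow_mul hσ0, show 2 / p * (p / 2) = 1 by field_simp, Real.rpow_one,
    Real.mul_rpow (by positivity) (Finset.sum_nonneg fun i _ => sq_nonneg _),
    ← Real.rpow_mul hr'.le] at h2
  rwa [show (2 / p - 1) * (p / 2) = 1 - p / 2 by field_simp] at h2

end BlockEstimates

/-! ### Sparse restricted isometry and the head estimate. -/

section RestrictedIsometry

variable {V : Type*} [NormedAddCommGroup V] [InnerProductSpace ℝ V]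

/-- Restricted isometry property of order `k` for the vectors `W i`, `i < ρ`. -/
def VectorRIP (W : ℕ → V) (ρ k : ℕ) (d : ℝ) : Prop :=
  ∀ (S : Finset ℕ) (c : ℕ → ℝ), S.card ≤ k → (∀ i, ρ ≤ i → c i = 0) →
    (1 - d) * ∑ i ∈ S, c i ^ 2 ≤ ‖∑ i ∈ S, c i • W i‖ ^ 2 ∧
      ‖∑ i ∈ S, c i • W i‖ ^ 2 ≤ (1 + d) * ∑ i ∈ S, c i ^ 2

/-- Polarization: scaling `x` by `β` and `y` by `±α` balances the two parts, and the two isometry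
bounds differ by `4 d α² β²`, against `4 α β ⟪x, y⟫`. -/
theorem VectorRIP.abs_inner_le {W : ℕ → V} {ρ k : ℕ} {d : ℝ} (h : VectorRIP W ρ k d)
    {S S' : Finset ℕ} (hd : Disjoint S S') (hc : S.card + S'.card ≤ k) {c : ℕ → ℝ}
    (hcρ : ∀ i, ρ ≤ i → c i = 0) :
    |⟪∑ i ∈ S, c i • W i, ∑ i ∈ S', c i • W i⟫_ℝ| ≤
      d * √(∑ i ∈ S, c i ^ 2) * √(∑ i ∈ S', c i ^ 2) := by
  classical
  set x := ∑ i ∈ S, c i • W i with hx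
  set y := ∑ i ∈ S', c i • W i with hy
  have hα0 : 0 ≤ ∑ i ∈ S, c i ^ 2 := Finset.sum_nonneg fun i _ => sq_nonneg _
  have hβ0 : 0 ≤ ∑ i ∈ S', c i ^ 2 := Finset.sum_nonneg fun i _ => sq_nonneg _
  have hα := Real.sq_sqrt hα0
  have hβ := Real.sq_sqrt hβ0
  set α := √(∑ i ∈ S, c i ^ 2) with hαdef
  set β := √(∑ i ∈ S', c i ^ 2) with hβdef
  have hα' : 0 ≤ α := Real.sqrt_nonneg _
  have hβ' : 0 ≤ β := Real.sqrt_nonneg _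
  have comb : ∀ a b : ℝ, (1 - d) * (a ^ 2 * α ^ 2 + b ^ 2 * β ^ 2) ≤ ‖a • x + b • y‖ ^ 2 ∧
      ‖a • x + b • y‖ ^ 2 ≤ (1 + d) * (a ^ 2 * α ^ 2 + b ^ 2 * β ^ 2) := by
    intro a b
    have h1 := h (S ∪ S') (fun i => (if i ∈ S then a else b) * c i)
      (by rw [Finset.card_union_of_disjoint hd]; exact hc)
      (fun i hi => by simp [hcρ i hi])
    have hS' : ∀ i ∈ S', i ∉ S := fun i hi hi' => Finset.disjoint_left.1 hd hi' hi
    have e1 : ∑ i ∈ S ∪ S', ((if i ∈ S then a else b) * c i) • W i = a • x + b • y := by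
      rw [Finset.sum_union hd, hx, hy, Finset.smul_sum, Finset.smul_sum]
      congr 1
      · exact Finset.sum_congr rfl fun i hi => by rw [if_pos hi, mul_smul]
      · exact Finset.sum_congr rfl fun i hi => by rw [if_neg (hS' i hi), mul_smul]
    have e2 : ∑ i ∈ S ∪ S', ((if i ∈ S then a else b) * c i) ^ 2 =
        a ^ 2 * α ^ 2 + b ^ 2 * β ^ 2 := by
      rw [Finset.sum_union hd, hα, hβ, Finset.mul_sum, Finset.mul_sum]
      congr 1
      · exact Finset.sum_congr rfl fun i hi => by rw [if_pos hi, mul_pow]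
      · exact Finset.sum_congr rfl fun i hi => by rw [if_neg (hS' i hi), mul_pow]
    rwa [e1, e2] at h1
  have expand : ∀ a b : ℝ, ‖a • x + b • y‖ ^ 2 =
      a ^ 2 * ‖x‖ ^ 2 + 2 * (a * b * ⟪x, y⟫_ℝ) + b ^ 2 * ‖y‖ ^ 2 := by
    intro a b
    rw [norm_add_sq_real, norm_smul, norm_smul, inner_smul_left, inner_smul_right, mul_pow,
      mul_pow, Real.norm_eq_abs, Real.norm_eq_abs, sq_abs, sq_abs, RCLike.conj_to_real]
    ring
  rcases hα'.eq_or_lt with hα1 | hα1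
  · have h1 := (comb 1 0).2
    rw [← hα1] at h1
    have : x = 0 := by simpa using h1
    simp [this, ← hα1]
  rcases hβ'.eq_or_lt with hβ1 | hβ1
  · have h1 := (comb 0 1).2
    rw [← hβ1] at h1
    have : y = 0 := by simpa using h1
    simp [this, ← hβ1]
  have h1 := comb β α
  have h2 := comb β (-α)
  rw [expand] at h1 h2
  have hαβ : 0 < 4 * (α * β) := by positivity
  rw [abs_le]
  constructor
  · refine le_of_mul_le_mul_left ?_ hαβ
    nlinarith
  · refine le_of_mul_le_mul_left ?_ hαβ
    nlinarith

/-- Pair the head image `x₀ + x₁` with the whole sum `v` and subtract the cross terms. The part of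
length `r` meets a block at order `k + r`, the part of length `k` at order `2 * k`; Cauchy–Schwarz
merges the two constants into `√(d₁ ^ 2 + d₂ ^ 2)`. Finally divide by the head norm. -/
theorem VectorRIP.head_le {W : ℕ → V} {ρ r k : ℕ} {d₁ d₂ : ℝ} (h₁ : VectorRIP W ρ (k + r) d₁)
    (h₂ : VectorRIP W ρ (2 * k) d₂) (hd₁ : 0 ≤ d₁) {s : ℕ → ℝ}
    (hsρ : ∀ i, ρ ≤ i → s i = 0) (L : ℕ) :
    (1 - d₁) * √(∑ i ∈ Finset.range (r + k), s i ^ 2) ≤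
      √(1 + d₁) * ‖∑ i ∈ Finset.range (r + (L + 1) * k), s i • W i‖ +
      √(d₁ ^ 2 + d₂ ^ 2) * ∑ j ∈ Finset.range L,
        √(∑ i ∈ Finset.Ico (r + (j + 1) * k) (r + (j + 2) * k), s i ^ 2) := by
  set y : ℕ → V := fun j => ∑ i ∈ Finset.Ico (r + (j + 1) * k) (r + (j + 2) * k), s i • W i
    with hy
  set β : ℕ → ℝ := fun j => √(∑ i ∈ Finset.Ico (r + (j + 1) * k) (r + (j + 2) * k), s i ^ 2)
    with hβ
  set x₀ := ∑ i ∈ Finset.range r, s i • W i with hx₀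
  set x₁ := ∑ i ∈ Finset.Ico r (r + k), s i • W i with hx₁
  have hsplit : ∀ L : ℕ, ∑ i ∈ Finset.range (r + (L + 1) * k), s i • W i =
      x₀ + x₁ + ∑ j ∈ Finset.range L, y j := by
    intro L
    induction L with
    | zero =>
      rw [hx₀, hx₁, Finset.sum_range_add_sum_Ico _ (show r ≤ r + k by omega)]
      simp
    | succ L ih =>
      rw [← Finset.sum_range_add_sum_Ico _ (show r + (L + 1) * k ≤ r + (L + 1 + 1) * k by
        rw [Nat.succ_mul (L + 1)]; omega), ih, Finset.sum_range_succ, ← add_assoc]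
  set v := ∑ i ∈ Finset.range (r + (L + 1) * k), s i • W i with hv
  have hvx : ∑ i ∈ Finset.range (r + k), s i • W i = x₀ + x₁ := by
    rw [hx₀, hx₁, Finset.sum_range_add_sum_Ico _ (show r ≤ r + k by omega)]
  have hq0 : 0 ≤ ∑ i ∈ Finset.range r, s i ^ 2 := Finset.sum_nonneg fun i _ => sq_nonneg _
  have hq1 : 0 ≤ ∑ i ∈ Finset.Ico r (r + k), s i ^ 2 := Finset.sum_nonneg fun i _ => sq_nonneg _
  have hqq : ∑ i ∈ Finset.range (r + k), s i ^ 2 =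
      √(∑ i ∈ Finset.range r, s i ^ 2) ^ 2 + √(∑ i ∈ Finset.Ico r (r + k), s i ^ 2) ^ 2 := by
    rw [Real.sq_sqrt hq0, Real.sq_sqrt hq1,
      Finset.sum_range_add_sum_Ico _ (show r ≤ r + k by omega)]
  set α₀ := √(∑ i ∈ Finset.range r, s i ^ 2) with hα₀
  set α₁ := √(∑ i ∈ Finset.Ico r (r + k), s i ^ 2) with hα₁
  have hrip := h₁ (Finset.range (r + k)) s (by rw [Finset.card_range]; omega) hsρ
  rw [hvx, hqq] at hrip
  rw [hqq]
  set h := √(α₀ ^ 2 + α₁ ^ 2) with hh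
  have hh2 : h ^ 2 = α₀ ^ 2 + α₁ ^ 2 := Real.sq_sqrt (by positivity)
  have hh0 : 0 ≤ h := Real.sqrt_nonneg _
  rw [← hh2] at hrip
  have hβ0 : ∀ j, 0 ≤ β j := fun j => Real.sqrt_nonneg _
  have hδ0 : 0 ≤ √(d₁ ^ 2 + d₂ ^ 2) := Real.sqrt_nonneg _
  have hcs : d₁ * α₀ + d₂ * α₁ ≤ √(d₁ ^ 2 + d₂ ^ 2) * h := by
    rw [hh, ← Real.sqrt_mul (by positivity)]
    apply Real.le_sqrt_of_sq_le
    nlinarith [sq_nonneg (d₁ * α₁ - d₂ * α₀)]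
  have hcross : ∀ j, -⟪x₀ + x₁, y j⟫_ℝ ≤ √(d₁ ^ 2 + d₂ ^ 2) * h * β j := by
    intro j
    have hjk : k ≤ (j + 1) * k := Nat.le_mul_of_pos_left k (by omega)
    have hcard : (r + (j + 2) * k) - (r + (j + 1) * k) = k := by
      rw [show r + (j + 2) * k = r + (j + 1) * k + k by ring]; omega
    have i0 := h₁.abs_inner_le (S := Finset.range r)
      (S' := Finset.Ico (r + (j + 1) * k) (r + (j + 2) * k)) (c := s)
      (by
        rw [Finset.disjoint_left]; intro i hi hi'
        rw [Finset.mem_range] at hi; rw [Finset.mem_Ico] at hi'; omega)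
      (by rw [Finset.card_range, Nat.card_Ico, hcard]; omega) hsρ
    have i1 := h₂.abs_inner_le (S := Finset.Ico r (r + k))
      (S' := Finset.Ico (r + (j + 1) * k) (r + (j + 2) * k)) (c := s)
      (by
        rw [Finset.disjoint_left]; intro i hi hi'
        rw [Finset.mem_Ico] at hi hi'; omega)
      (by rw [Nat.card_Ico, Nat.card_Ico, hcard]; omega) hsρ
    change |⟪x₀, y j⟫_ℝ| ≤ d₁ * α₀ * β j at i0
    change |⟪x₁, y j⟫_ℝ| ≤ d₂ * α₁ * β j at i1
    rw [inner_add_left]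
    have := mul_le_mul_of_nonneg_right hcs (hβ0 j)
    have := (abs_le.1 i0).1
    have := (abs_le.1 i1).1
    linarith
  have hnx : ‖x₀ + x₁‖ ≤ √(1 + d₁) * h := by
    refine le_of_sq_le_sq ?_ (by positivity)
    rw [mul_pow, Real.sq_sqrt (by linarith)]
    exact hrip.2
  have hmain : ‖x₀ + x₁‖ ^ 2 ≤ √(1 + d₁) * h * ‖v‖ +
      √(d₁ ^ 2 + d₂ ^ 2) * h * ∑ j ∈ Finset.range L, β j := by
    have e : ‖x₀ + x₁‖ ^ 2 = ⟪x₀ + x₁, v⟫_ℝ + ∑ j ∈ Finset.range L, -⟪x₀ + x₁, y j⟫_ℝ := by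
      rw [hv, hsplit L, inner_add_right, inner_sum, real_inner_self_eq_norm_sq,
        Finset.sum_neg_distrib]
      ring
    rw [e, Finset.mul_sum]
    refine add_le_add ?_ (Finset.sum_le_sum fun j _ => hcross j)
    exact (real_inner_le_norm _ _).trans (mul_le_mul_of_nonneg_right hnx (norm_nonneg _))
  have hβs : 0 ≤ ∑ j ∈ Finset.range L, β j := Finset.sum_nonneg fun j _ => hβ0 j
  rcases hh0.eq_or_lt with h0 | h0
  · rw [← h0, mul_zero]; positivity
  · refine le_of_mul_le_mul_right ?_ h0
    have := hrip.1.trans hmain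
    linarith

end RestrictedIsometry

/-! ### Recovery bounds for decreasing sequences. -/

section Recovery

theorem sqrt_rpow_eq {q : ℝ} (hq : 0 ≤ q) (p : ℝ) : √q ^ p = q ^ (p / 2) := by
  rw [Real.sqrt_eq_rpow, ← Real.rpow_mul hq]
  congr 1; ring

theorem sum_range_eq_of_forall_eq_zero {α : Type*} [AddCommMonoid α] {ρ N : ℕ} (hρN : ρ ≤ N)
    (f : ℕ → α) (hf : ∀ i, ρ ≤ i → f i = 0) :
    ∑ i ∈ Finset.range ρ, f i = ∑ i ∈ Finset.range N, f i :=
  Finset.sum_subset (Finset.range_mono hρN) fun i _ hi => hf i (not_lt.1 (by simpa using hi))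

/-- With `b = a ^ (1/2 - 1/p)` the hypothesis says `d₂ (1 + √2 b) < 1`. Since `a ^ (p/2 - 1) = b ^
p`, positivity of `errDenom` amounts to `b √(d₁² + d₂²) < 1 - d₁`, and `√(d₁² + d₂²) ≤ √2 d₂`. -/
theorem hatDelta_bounds_of_lt {p a d₁ d₂ : ℝ} (hp0 : 0 < p) (ha : 0 < a) (hd₁ : 0 ≤ d₁)
    (hd₁₂ : d₁ ≤ d₂) (hd₂ : 1 + d₂ < (2 + √2 * a ^ (1 / 2 - 1 / p)) /
      (1 + √2 * a ^ (1 / 2 - 1 / p))) :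
    d₁ < 1 ∧ 0 < errDenom p a d₁ d₂ := by
  set b := a ^ (1 / 2 - 1 / p) with hb
  have hb0 : 0 < b := Real.rpow_pos_of_pos ha _
  have hs0 : 0 < √2 * b := by positivity
  have hlt : d₂ * (1 + √2 * b) < 1 := by
    rw [lt_div_iff₀ (by positivity)] at hd₂
    linarith
  have hd₂0 : 0 ≤ d₂ := hd₁.trans hd₁₂
  have hd₂1 : d₂ < 1 := by nlinarith
  have hd : d₁ < 1 := hd₁₂.trans_lt hd₂1
  refine ⟨hd, ?_⟩
  rw [errDenom, sub_pos, ← sqrt_rpow_eq (by positivity)]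
  have e : a ^ (p / 2 - 1) = b ^ p := by
    rw [hb, ← Real.rpow_mul ha.le]
    congr 1; field_simp
  rw [e, ← Real.mul_rpow hb0.le (Real.sqrt_nonneg _)]
  refine Real.rpow_lt_rpow (by positivity) ?_ hp0
  have h1 : √(d₁ ^ 2 + d₂ ^ 2) ≤ √2 * d₂ := by
    rw [Real.sqrt_le_left (by positivity), mul_pow, Real.sq_sqrt (by norm_num)]
    nlinarith
  calc b * √(d₁ ^ 2 + d₂ ^ 2) ≤ b * (√2 * d₂) := by gcongr
    _ < 1 - d₂ := by nlinarith
    _ ≤ 1 - d₁ := by linarith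

variable {V : Type*} [NormedAddCommGroup V] [InnerProductSpace ℝ V]

theorem recovery_bounds {W : ℕ → V} {ρ r k : ℕ} {p a d₁ d₂ η τ : ℝ} (hp0 : 0 < p) (hp1 : p ≤ 1)
    (hr : 1 ≤ r) (ha : 1 < a) (hk : (k : ℝ) = a * r)
    (h₁ : VectorRIP W ρ (k + r) d₁) (h₂ : VectorRIP W ρ (2 * k) d₂) (hd₁ : 0 ≤ d₁)
    (hd₁' : d₁ < 1) (hD : 0 < errDenom p a d₁ d₂) {s : ℕ → ℝ} (hs0 : ∀ i, 0 ≤ s i)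
    (hs : Antitone s) (hsρ : ∀ i, ρ ≤ i → s i = 0) (hη : 0 ≤ η) (hτ : 0 ≤ τ)
    (hv : ‖∑ i ∈ Finset.range ρ, s i • W i‖ ≤ 2 * η)
    (htail : ∀ N, ∑ i ∈ Finset.Ico r N, s i ^ p ≤ ∑ i ∈ Finset.range r, s i ^ p + 2 * τ) :
    √(∑ i ∈ Finset.range ρ, s i ^ 2) ^ p ≤
        errC1 p a d₁ d₂ * η ^ p + errC2 p a d₁ d₂ * (τ / (r : ℝ) ^ (1 - p / 2)) ∧
      ∑ i ∈ Finset.range ρ, s i ^ p ≤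
        errC1' p a d₁ d₂ * (r : ℝ) ^ (1 - p / 2) * η ^ p + errC2' p a d₁ d₂ * τ := by
  have hr' : (0 : ℝ) < r := by exact_mod_cast hr
  have ha0 : 0 < a := by linarith
  have hk' : (0 : ℝ) < k := by rw [hk]; positivity
  have hk0 : 0 < k := by exact_mod_cast hk'
  -- The head and `ρ` further blocks, each of length at least one, cover all indices below `ρ`; the
  -- rest is zero padding.
  set N := r + (ρ + 1) * k with hN
  have hρN : ρ ≤ N := by
    have : (ρ + 1) ≤ (ρ + 1) * k := Nat.le_mul_of_pos_right _ hk0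
    omega
  have hhead := h₁.head_le h₂ hd₁ hsρ ρ
  rw [← hN, ← sum_range_eq_of_forall_eq_zero hρN (fun i => s i • W i) (fun i hi => by simp [hsρ i hi])] at hhead
  set β : ℕ → ℝ := fun j => √(∑ i ∈ Finset.Ico (r + (j + 1) * k) (r + (j + 2) * k), s i ^ 2)
    with hβ
  have hβ0 : ∀ j, 0 ≤ β j := fun j => Real.sqrt_nonneg _
  set Q₀ := (∑ i ∈ Finset.range r, s i ^ 2) ^ (p / 2) with hQ₀
  set h := √(∑ i ∈ Finset.range (r + k), s i ^ 2) with hh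
  set g := a ^ (p / 2 - 1) with hg
  set R := (r : ℝ) ^ (1 - p / 2) with hR
  set Δ := (d₁ ^ 2 + d₂ ^ 2) ^ (p / 2) with hΔ
  have hg0 : 0 < g := Real.rpow_pos_of_pos ha0 _
  have hR0 : 0 < R := Real.rpow_pos_of_pos hr' _
  have hΔ0 : 0 ≤ Δ := by positivity
  have hsq0 : ∀ S : Finset ℕ, 0 ≤ ∑ i ∈ S, s i ^ 2 := fun S =>
    Finset.sum_nonneg fun i _ => sq_nonneg _
  have hQh : Q₀ ≤ h ^ p := by
    rw [hh, sqrt_rpow_eq (hsq0 _)]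
    refine Real.rpow_le_rpow (hsq0 _) ?_ (by positivity)
    exact Finset.sum_le_sum_of_subset_of_nonneg (Finset.range_mono (by omega))
      fun i _ _ => sq_nonneg _
  have hhead_p : ∑ i ∈ Finset.range r, s i ^ p ≤ R * Q₀ :=
    sum_rpow_le_card_rpow_mul hp0 hp1 hs0 hr
  set T := τ / R with hT
  have hTR : τ = R * T := by rw [hT]; field_simp
  have hT0 : 0 ≤ T := div_nonneg hτ hR0.le
  have hkg : (k : ℝ) ^ (p / 2 - 1) * R = g := by
    rw [hk, Real.mul_rpow ha0.le hr'.le, hR, mul_assoc, ← Real.rpow_add hr',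
      show p / 2 - 1 + (1 - p / 2) = 0 by ring, Real.rpow_zero, mul_one]
  have hβs : ∑ j ∈ Finset.range ρ, β j ^ p ≤ g * (h ^ p + 2 * T) := by
    have h0 := sum_sq_blocks_rpow_le hp0 hs0 hs hk0 r ρ
    have h1 := (htail (r + ρ * k)).trans (add_le_add_left hhead_p _)
    have h2 : ∑ j ∈ Finset.range ρ, β j ^ p ≤ (k : ℝ) ^ (p / 2 - 1) * (R * Q₀ + 2 * τ) := by
      refine le_trans (le_of_eq (Finset.sum_congr rfl fun j _ => sqrt_rpow_eq (hsq0 _) p))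
        (h0.trans ?_)
      gcongr
    refine h2.trans ?_
    rw [hTR, show (k : ℝ) ^ (p / 2 - 1) * (R * Q₀ + 2 * (R * T)) =
      ((k : ℝ) ^ (p / 2 - 1) * R) * (Q₀ + 2 * T) by ring, hkg]
    gcongr
  set e := 2 ^ p * (1 + d₁) ^ (p / 2) * η ^ p with he
  -- Subadditivity of `t^p` distributes the power over the head estimate. The term in `h ^ p` on the
  -- right is absorbed on the left, leaving the factor `D`.
  have hmain : (1 - d₁) ^ p * h ^ p ≤ e + Δ * (g * (h ^ p + 2 * T)) := by
    rw [← Real.mul_rpow (by linarith) (Real.sqrt_nonneg _)]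
    refine (Real.rpow_le_rpow (mul_nonneg (by linarith) (Real.sqrt_nonneg _)) hhead
      hp0.le).trans ?_
    have hβsum : 0 ≤ ∑ j ∈ Finset.range ρ, β j := Finset.sum_nonneg fun j _ => hβ0 j
    refine (Real.rpow_add_le_add_rpow (by positivity) (by positivity) hp0.le hp1).trans ?_
    refine add_le_add ?_ ?_
    · rw [Real.mul_rpow (by positivity) (norm_nonneg _), sqrt_rpow_eq (by linarith), he,
        mul_comm (2 ^ p), mul_assoc, ← Real.mul_rpow (by norm_num) hη]
      gcongr
    · rw [Real.mul_rpow (by positivity) hβsum, sqrt_rpow_eq (by positivity)]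
      exact mul_le_mul_of_nonneg_left
        ((rpow_sum_le_sum_rpow hp0 hp1 _ _ hβ0).trans hβs) hΔ0
  set D := errDenom p a d₁ d₂ with hDdef
  have hDe : D = (1 - d₁) ^ p - g * Δ := rfl
  have hh0 : 0 ≤ h ^ p := Real.rpow_nonneg (Real.sqrt_nonneg _) p
  have hhp : h ^ p ≤ (e + 2 * g * Δ * T) / D := by
    rw [le_div_iff₀ hD, hDe]
    linarith
  constructor
  · have htot : √(∑ i ∈ Finset.range ρ, s i ^ 2) ^ p ≤
        h ^ p + ∑ j ∈ Finset.range ρ, β j ^ p := by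
      have hsplit : ∀ L : ℕ, ∑ i ∈ Finset.range (r + (L + 1) * k), s i ^ 2 =
          ∑ i ∈ Finset.range (r + k), s i ^ 2 + ∑ j ∈ Finset.range L,
            ∑ i ∈ Finset.Ico (r + (j + 1) * k) (r + (j + 2) * k), s i ^ 2 := by
        intro L
        induction L with
        | zero => simp
        | succ L ih =>
          rw [← Finset.sum_range_add_sum_Ico _ (show r + (L + 1) * k ≤ r + (L + 1 + 1) * k by
            rw [Nat.succ_mul (L + 1)]; omega), ih, Finset.sum_range_succ, ← add_assoc]
      rw [sum_range_eq_of_forall_eq_zero hρN (fun i => s i ^ 2) (fun i hi => by simp [hsρ i hi]), hN, hsplit ρ,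
        sqrt_rpow_eq (add_nonneg (hsq0 _) (Finset.sum_nonneg fun j _ => hsq0 _)),
        hh, sqrt_rpow_eq (hsq0 _)]
      refine (Real.rpow_add_le_add_rpow (hsq0 _) (Finset.sum_nonneg fun j _ => hsq0 _)
        (by positivity) (by linarith)).trans (add_le_add_right ?_ _)
      refine (rpow_sum_le_sum_rpow (by positivity) (by linarith) _ _ fun j => hsq0 _).trans ?_
      exact le_of_eq (Finset.sum_congr rfl fun j _ => (sqrt_rpow_eq (hsq0 _) p).symm)
    have h3 : √(∑ i ∈ Finset.range ρ, s i ^ 2) ^ p ≤ (1 + g) * h ^ p + 2 * g * T := by linarith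
    have h4 := mul_le_mul_of_nonneg_left hhp (show 0 ≤ 1 + g by positivity)
    have e1 : errC1 p a d₁ d₂ * η ^ p = (1 + g) * e / D := by
      rw [errC1, he, ← hg, ← hDdef]; ring
    have e2 : errC2 p a d₁ d₂ * T = (1 + g) * (2 * g * Δ * T) / D + 2 * g * T := by
      rw [errC2, ← hg, ← hΔ, ← hDdef]; ring
    rw [e1, e2]
    have e3 : (1 + g) * ((e + 2 * g * Δ * T) / D) =
      (1 + g) * e / D + (1 + g) * (2 * g * Δ * T) / D := by ring
    linarith
  · have h5 : ∑ i ∈ Finset.range ρ, s i ^ p ≤ 2 * (R * h ^ p) + 2 * τ := by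
      have hrN : r ≤ N := by omega
      rw [sum_range_eq_of_forall_eq_zero hρN (fun i => s i ^ p) (fun i hi => by simp [hsρ i hi, Real.zero_rpow hp0.ne']),
        ← Finset.sum_range_add_sum_Ico _ hrN]
      have := htail N
      have := mul_le_mul_of_nonneg_left hQh hR0.le
      linarith
    set G := (1 + a) ^ (1 - p / 2) with hG
    have hG1 : 1 ≤ G := Real.one_le_rpow (by linarith) (by linarith)
    have he0 : 0 ≤ e := by positivity
    have e1 : errC1' p a d₁ d₂ * R * η ^ p = G * (2 * R * e / D) := by
      rw [errC1', he, ← hG, ← hDdef, Real.rpow_add_one (by norm_num)]; ring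
    have e2 : errC2' p a d₁ d₂ * τ = 2 * τ + G * (4 * g * Δ * (R * T) / D) := by
      rw [errC2', ← hg, ← hΔ, ← hDdef, ← hG, ← hTR]; ring
    rw [e1, e2]
    have n1 : 0 ≤ 2 * R * e / D := by positivity
    have n2 : 0 ≤ 4 * g * Δ * (R * T) / D := by positivity
    have h6 := mul_le_mul_of_nonneg_left hhp (show 0 ≤ 2 * R by positivity)
    have e3 : 2 * R * ((e + 2 * g * Δ * T) / D) =
      2 * R * e / D + 4 * g * Δ * (R * T) / D := by ring
    nlinarith

/-- Cut into blocks of length `r`. The block estimate at exponent one sums the norms of all blocks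
after the first to at most `(∑ s i) / √r`. -/
theorem VectorRIP.norm_sum_le {W : ℕ → V} {ρ r : ℕ} {d : ℝ} (h : VectorRIP W ρ r d)
    (hr : 1 ≤ r) (hd : 0 ≤ d) {s : ℕ → ℝ} (hs0 : ∀ i, 0 ≤ s i) (hs : Antitone s)
    (hsρ : ∀ i, ρ ≤ i → s i = 0) :
    ‖∑ i ∈ Finset.range ρ, s i • W i‖ ≤
      √(1 + d) * (√(∑ i ∈ Finset.range ρ, s i ^ 2) + (∑ i ∈ Finset.range ρ, s i) / √r) := by
  have hle : ∀ S : Finset ℕ, S.card ≤ r →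
      ‖∑ i ∈ S, s i • W i‖ ≤ √(1 + d) * √(∑ i ∈ S, s i ^ 2) := by
    intro S hS
    rw [← Real.sqrt_mul (by linarith)]
    exact Real.le_sqrt_of_sq_le (h S s hS hsρ).2
  have hsplit : ∀ L : ℕ, ∑ i ∈ Finset.range ((L + 1) * r), s i • W i =
      ∑ i ∈ Finset.range r, s i • W i + ∑ j ∈ Finset.range L,
        ∑ i ∈ Finset.Ico ((j + 1) * r) ((j + 2) * r), s i • W i := by
    intro L
    induction L with
    | zero => simp
    | succ L ih =>
      rw [← Finset.sum_range_add_sum_Ico _ (show (L + 1) * r ≤ (L + 1 + 1) * r by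
        rw [Nat.succ_mul (L + 1)]; omega), ih, Finset.sum_range_succ, ← add_assoc]
  have hρr : ρ ≤ ρ * r := Nat.le_mul_of_pos_right _ hr
  have hρN : ρ ≤ (ρ + 1) * r := by rw [Nat.succ_mul]; omega
  have hblocks := sum_sq_blocks_rpow_le one_pos hs0 hs (show 0 < r from hr) 0 ρ
  simp only [zero_add, Real.rpow_one] at hblocks
  rw [← Finset.range_eq_Ico, ← sum_range_eq_of_forall_eq_zero hρr s hsρ] at hblocks
  have hpow : (r : ℝ) ^ ((1 : ℝ) / 2 - 1) = (√r)⁻¹ := by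
    rw [Real.sqrt_eq_rpow, ← Real.rpow_neg (Nat.cast_nonneg r)]
    norm_num
  rw [hpow] at hblocks
  rw [sum_range_eq_of_forall_eq_zero hρN (fun i => s i • W i) (fun i hi => by simp [hsρ i hi]),
    hsplit, mul_add]
  refine (norm_add_le _ _).trans (add_le_add ?_ ?_)
  · refine (hle _ (by simp)).trans (mul_le_mul_of_nonneg_left ?_ (Real.sqrt_nonneg _))
    apply Real.sqrt_le_sqrt
    rw [sum_range_eq_of_forall_eq_zero (show ρ ≤ ρ + r by omega) (fun i => s i ^ 2)
      (fun i hi => by simp [hsρ i hi])]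
    exact Finset.sum_le_sum_of_subset_of_nonneg (Finset.range_mono (by omega))
      fun i _ _ => sq_nonneg _
  · refine (_root_.norm_sum_le _ _).trans ?_
    refine (Finset.sum_le_sum fun j _ => hle _ ?_).trans ?_
    · rw [Nat.card_Ico, show (j + 2) * r = (j + 1) * r + r by ring]; omega
    · rw [← Finset.mul_sum]
      refine mul_le_mul_of_nonneg_left ?_ (Real.sqrt_nonneg _)
      rw [div_eq_inv_mul]
      refine le_trans (le_of_eq (Finset.sum_congr rfl fun j _ => ?_)) hblocks
      rw [Real.sqrt_eq_rpow]

end Recovery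

/-! ### Singular values, rank and Frobenius norm of matrices. -/

section MatrixFacts

variable {m n : ℕ}

theorem finrank_range_toEuclideanLin (X : Matrix (Fin m) (Fin n) ℝ) :
    finrank ℝ (LinearMap.range (Matrix.toEuclideanLin X)) = X.rank := by
  rw [Matrix.toEuclideanLin, Matrix.toLpLin_eq_toLin]
  exact (X.rank_eq_finrank_range_toLin _ _).symm

theorem matSingularValue_eq_zero {X : Matrix (Fin m) (Fin n) ℝ} {i : ℕ} (hi : X.rank ≤ i) :
    matSingularValue X i = 0 := by
  rw [← finrank_range_toEuclideanLin] at hi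
  exact (LinearMap.singularValues_eq_zero_iff_le_finrank_range _).2 hi

theorem rank_le_min (X : Matrix (Fin m) (Fin n) ℝ) : X.rank ≤ min m n :=
  le_min X.rank_le_height X.rank_le_width

theorem matSingularValue_nonneg (X : Matrix (Fin m) (Fin n) ℝ) (i : ℕ) :
    0 ≤ matSingularValue X i :=
  LinearMap.singularValues_nonneg _ i

theorem matSingularValue_antitone (X : Matrix (Fin m) (Fin n) ℝ) :
    Antitone (matSingularValue X) :=
  LinearMap.singularValues_antitone _

theorem matSingularValue_add_rank_le (X Y : Matrix (Fin m) (Fin n) ℝ) {r : ℕ} (hY : Y.rank ≤ r)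
    (i : ℕ) : matSingularValue X (i + r) ≤ matSingularValue (X - Y) i := by
  have h := LinearMap.singularValues_add_finrank_range_le (Matrix.toEuclideanLin (X - Y))
    (Matrix.toEuclideanLin Y) (j := r) (by rwa [finrank_range_toEuclideanLin]) i
  rwa [← map_add, sub_add_cancel] at h

theorem sum_abs_rpow_matSingularValue_sub_le {p : ℝ} (hp0 : 0 ≤ p) (hp1 : p ≤ 1)
    (X Y : Matrix (Fin m) (Fin n) ℝ) :
    ∑ i ∈ Finset.range (min m n), |matSingularValue X i ^ p - matSingularValue Y i ^ p| ≤
      ∑ i ∈ Finset.range (min m n), matSingularValue (X - Y) i ^ p := by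
  have h := sum_abs_rpow_singularValues_sub_le hp0 hp1 (Matrix.toEuclideanLin X)
    (Matrix.toEuclideanLin Y) (K := min m n) (by simp) (by simp)
  rw [← map_sub, finrank_range_toEuclideanLin] at h
  exact h.trans (Finset.sum_le_sum_of_subset_of_nonneg (Finset.range_mono (rank_le_min _))
    fun i _ _ => Real.rpow_nonneg (matSingularValue_nonneg _ i) p)

theorem schattenNorm_rpow {p : ℝ} (hp : 0 < p) (X : Matrix (Fin m) (Fin n) ℝ) :
    schattenNorm p X ^ p = ∑ i ∈ Finset.range (min m n), matSingularValue X i ^ p := by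
  rw [schattenNorm, ← Real.rpow_mul
    (Finset.sum_nonneg fun i _ => Real.rpow_nonneg (matSingularValue_nonneg _ i) p),
    one_div_mul_cancel hp.ne', Real.rpow_one]

theorem exists_matrix_singular_vectors (X : Matrix (Fin m) (Fin n) ℝ) :
    ∃ (u : ℕ → Fin m → ℝ) (v : ℕ → Fin n → ℝ),
      (∀ i < X.rank, ∀ j < X.rank, u i ⬝ᵥ u j = if i = j then 1 else 0) ∧
      (∀ i < X.rank, ∀ j < X.rank, v i ⬝ᵥ v j = if i = j then 1 else 0) ∧
      X = ∑ i ∈ Finset.range X.rank, matSingularValue X i • Matrix.vecMulVec (u i) (v i) := by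
  obtain ⟨u, v, hu, hv, -, hX⟩ := (Matrix.toEuclideanLin X).exists_singular_vectors
  rw [finrank_range_toEuclideanLin] at hu hv hX
  rw [orthonormal_iff_ite] at hu hv
  refine ⟨fun i => (u i).ofLp, fun i => (v i).ofLp, fun i hi j hj => ?_, fun i hi j hj => ?_, ?_⟩
  · have := hu ⟨j, hj⟩ ⟨i, hi⟩
    rw [EuclideanSpace.inner_eq_star_dotProduct, star_trivial] at this
    rw [this]; simp [eq_comm]
  · have := hv ⟨j, hj⟩ ⟨i, hi⟩
    rw [EuclideanSpace.inner_eq_star_dotProduct, star_trivial] at this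
    rw [this]; simp [eq_comm]
  · ext a b
    have h := congrArg (fun w : EuclideanSpace ℝ (Fin m) => w a)
      (hX (EuclideanSpace.single b 1))
    simp only [Matrix.toEuclideanLin, Matrix.toLpLin_apply] at h
    simp only [PiLp.ofLp_single, Matrix.mulVec_single_one, Matrix.col_apply,
      EuclideanSpace.inner_single_right, WithLp.ofLp_sum, Finset.sum_apply, WithLp.ofLp_smul,
      Pi.smul_apply, smul_eq_mul, RCLike.conj_to_real, one_mul] at h
    rw [h, Matrix.sum_apply]
    refine Finset.sum_congr rfl fun i _ => ?_
    simp only [Matrix.smul_apply, Matrix.vecMulVec_apply, smul_eq_mul, matSingularValue]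
    ring

theorem trace_transpose_mul_self (X : Matrix (Fin m) (Fin n) ℝ) :
    (X.transpose * X).trace = ∑ j, ∑ i, X i j ^ 2 := by
  simp [Matrix.trace, Matrix.mul_apply, pow_two]

theorem frobNorm_nonneg (X : Matrix (Fin m) (Fin n) ℝ) : 0 ≤ frobNorm X := Real.sqrt_nonneg _

theorem frobNorm_sq (X : Matrix (Fin m) (Fin n) ℝ) :
    frobNorm X ^ 2 = (X.transpose * X).trace := by
  rw [frobNorm, Real.sq_sqrt]
  rw [trace_transpose_mul_self]
  exact Finset.sum_nonneg fun j _ => Finset.sum_nonneg fun i _ => sq_nonneg _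

theorem abs_apply_le_frobNorm (X : Matrix (Fin m) (Fin n) ℝ) (i : Fin m) (j : Fin n) :
    |X i j| ≤ frobNorm X := by
  refine abs_le_of_sq_le_sq ?_ (frobNorm_nonneg X)
  rw [frobNorm_sq, trace_transpose_mul_self]
  exact (Finset.single_le_sum (f := fun i => X i j ^ 2) (fun i _ => sq_nonneg _)
    (Finset.mem_univ i)).trans (Finset.single_le_sum (f := fun j => ∑ i, X i j ^ 2)
      (fun j _ => Finset.sum_nonneg fun i _ => sq_nonneg _) (Finset.mem_univ j))

theorem frobNorm_pos {X : Matrix (Fin m) (Fin n) ℝ} (hX : X ≠ 0) : 0 < frobNorm X := by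
  refine (frobNorm_nonneg X).lt_of_ne fun h => hX ?_
  ext i j
  have := abs_apply_le_frobNorm X i j
  rw [← h] at this
  exact abs_nonpos_iff.1 this

theorem frobNorm_zero : frobNorm (0 : Matrix (Fin m) (Fin n) ℝ) = 0 := by
  simp [frobNorm]

theorem frobNorm_sq_sum_vecMulVec {u : ℕ → Fin m → ℝ} {v : ℕ → Fin n → ℝ} {ρ : ℕ}
    (hu : ∀ i < ρ, ∀ j < ρ, u i ⬝ᵥ u j = if i = j then 1 else 0)
    (hv : ∀ i < ρ, ∀ j < ρ, v i ⬝ᵥ v j = if i = j then 1 else 0) (S : Finset ℕ) (c : ℕ → ℝ)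
    (hc : ∀ i, ρ ≤ i → c i = 0) :
    frobNorm (∑ i ∈ S, c i • Matrix.vecMulVec (u i) (v i)) ^ 2 = ∑ i ∈ S, c i ^ 2 := by
  rw [frobNorm_sq, Matrix.transpose_sum, Matrix.sum_mul, Matrix.trace_sum]
  refine Finset.sum_congr rfl fun i hi => ?_
  rw [Matrix.mul_sum, Matrix.trace_sum, Finset.sum_eq_single i]
  · by_cases h : i < ρ
    · rw [Matrix.transpose_smul, Matrix.transpose_vecMulVec, Matrix.smul_mul, Matrix.mul_smul,
        Matrix.vecMulVec_mul_vecMulVec, Matrix.trace_smul, Matrix.trace_smul, hu i h i h,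
        if_pos rfl, one_smul, Matrix.trace_vecMulVec, hv i h i h, if_pos rfl]
      simp [pow_two]
    · simp [hc i (not_lt.1 h)]
  · intro j _ hji
    by_cases h : i < ρ ∧ j < ρ
    · rw [Matrix.transpose_smul, Matrix.transpose_vecMulVec, Matrix.smul_mul, Matrix.mul_smul,
        Matrix.vecMulVec_mul_vecMulVec, hu i h.1 j h.2, if_neg (Ne.symm hji)]
      simp
    · rcases not_and_or.1 h with h | h
      · simp [hc i (not_lt.1 h)]
      · simp [hc j (not_lt.1 h)]
  · exact fun h => absurd hi h

theorem rank_sum_vecMulVec_le (u : ℕ → Fin m → ℝ) (v : ℕ → Fin n → ℝ) (S : Finset ℕ)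
    (c : ℕ → ℝ) : (∑ i ∈ S, c i • Matrix.vecMulVec (u i) (v i)).rank ≤ S.card := by
  classical
  have h : LinearMap.range (∑ i ∈ S, c i • Matrix.vecMulVec (u i) (v i)).mulVecLin ≤
      Submodule.span ℝ (S.image u : Set (Fin m → ℝ)) := by
    rintro _ ⟨x, rfl⟩
    rw [Matrix.mulVecLin_apply, Matrix.sum_mulVec]
    refine Submodule.sum_mem _ fun i hi => ?_
    rw [Matrix.smul_mulVec, Matrix.vecMulVec_mulVec]
    refine Submodule.smul_mem _ _ ?_
    have : MulOpposite.op (v i ⬝ᵥ x) • u i = (v i ⬝ᵥ x) • u i := by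
      ext; simp [mul_comm]
    rw [this]
    exact Submodule.smul_mem _ _ (Submodule.subset_span (by
      exact_mod_cast Finset.mem_image_of_mem u hi))
  exact (Submodule.finrank_mono h).trans ((finrank_span_finset_le_card _).trans
    Finset.card_image_le)

theorem frobNorm_eq_sqrt_sum (X : Matrix (Fin m) (Fin n) ℝ) :
    frobNorm X = √(∑ i ∈ Finset.range X.rank, matSingularValue X i ^ 2) := by
  obtain ⟨u, v, hu, hv, hX⟩ := exists_matrix_singular_vectors X
  have h := frobNorm_sq_sum_vecMulVec hu hv (Finset.range X.rank) (matSingularValue X)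
    (fun i hi => matSingularValue_eq_zero hi)
  rw [← hX] at h
  rw [← h, Real.sqrt_sq (frobNorm_nonneg X)]

/-- A matrix carrying one nonzero entry of `X` has rank at most one and strictly beats `0`. This
makes the denominators `‖Xr‖_F` genuine. -/
theorem best_rank_approx_ne_zero {r : ℕ} (hr : 1 ≤ r) {X Xr : Matrix (Fin m) (Fin n) ℝ}
    (hX : X ≠ 0) (h : IsBestRankApprox r X Xr) : Xr ≠ 0 := by
  rintro rfl
  obtain ⟨i, j, hij⟩ : ∃ i j, X i j ≠ 0 := by
    by_contra! hc
    exact hX (by ext i j; exact hc i j)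
  set Y : Matrix (Fin m) (Fin n) ℝ := Matrix.vecMulVec (Pi.single i 1) (Pi.single j (X i j))
    with hY
  have h1 := h.2 Y ((Matrix.rank_vecMulVec_le _ _).trans hr)
  rw [sub_zero] at h1
  have h2 := pow_le_pow_left₀ (frobNorm_nonneg X) h1 2
  rw [frobNorm_sq, frobNorm_sq, trace_transpose_mul_self, trace_transpose_mul_self] at h2
  refine absurd h2 (not_le.2 ?_)
  have hle : ∀ b a, (X - Y) a b ^ 2 ≤ X a b ^ 2 := by
    intro b a
    rw [Matrix.sub_apply, hY, Matrix.vecMulVec_apply]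
    by_cases ha : a = i <;> by_cases hb : b = j <;>
      simp [ha, hb, sq_nonneg]
  refine Finset.sum_lt_sum (fun b _ => Finset.sum_le_sum fun a _ => hle b a)
    ⟨j, Finset.mem_univ j, Finset.sum_lt_sum (fun a _ => hle j a) ⟨i, Finset.mem_univ i, ?_⟩⟩
  rw [Matrix.sub_apply, hY, Matrix.vecMulVec_apply]
  simp [sq_pos_of_ne_zero hij]

end MatrixFacts

/-! ### Operator norms, perturbed isometry constants and feasibility of `X`. -/

section OperatorBounds

variable {m n M : ℕ} (A E : Matrix (Fin m) (Fin n) ℝ →ₗ[ℝ] EuclideanSpace ℝ (Fin M))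

theorem exists_norm_le_mul_frobNorm : ∃ C : ℝ, 0 ≤ C ∧ ∀ X, ‖A X‖ ≤ C * frobNorm X := by
  refine ⟨∑ i, ∑ j, ‖A (Matrix.single i j 1)‖, by positivity, fun X => ?_⟩
  conv_lhs => rw [Matrix.matrix_eq_sum_single X, map_sum]
  refine (norm_sum_le _ _).trans ?_
  rw [Finset.sum_mul]
  refine Finset.sum_le_sum fun i _ => ?_
  rw [map_sum, Finset.sum_mul]
  refine (norm_sum_le _ _).trans (Finset.sum_le_sum fun j _ => ?_)
  have : Matrix.single i j (X i j) = X i j • Matrix.single i j (1 : ℝ) := by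
    rw [Matrix.smul_single, smul_eq_mul, mul_one]
  rw [this, map_smul, norm_smul, Real.norm_eq_abs, mul_comm]
  exact mul_le_mul_of_nonneg_left (abs_apply_le_frobNorm X i j) (norm_nonneg _)

theorem norm_le_opNorm_mul (X : Matrix (Fin m) (Fin n) ℝ) : ‖A X‖ ≤ opNorm A * frobNorm X := by
  by_cases hX : X = 0
  · simp [hX, frobNorm_zero]
  obtain ⟨C, hC, h⟩ := exists_norm_le_mul_frobNorm A
  rw [← div_le_iff₀ (frobNorm_pos hX)]
  refine le_csSup ⟨C, ?_⟩ ⟨X, hX, rfl⟩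
  rintro _ ⟨Y, hY, rfl⟩
  rw [div_le_iff₀ (frobNorm_pos hY)]
  exact h Y

theorem norm_le_opNormRank_mul {k : ℕ} {X : Matrix (Fin m) (Fin n) ℝ} (hXk : X.rank ≤ k) :
    ‖A X‖ ≤ opNormRank k A * frobNorm X := by
  by_cases hX : X = 0
  · simp [hX, frobNorm_zero]
  obtain ⟨C, hC, h⟩ := exists_norm_le_mul_frobNorm A
  rw [← div_le_iff₀ (frobNorm_pos hX)]
  refine le_csSup ⟨C, ?_⟩ ⟨X, hX, hXk, rfl⟩
  rintro _ ⟨Y, hY, -, rfl⟩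
  rw [div_le_iff₀ (frobNorm_pos hY)]
  exact h Y

theorem opNorm_nonneg : 0 ≤ opNorm A := by
  refine Real.sSup_nonneg ?_
  rintro _ ⟨Y, -, rfl⟩
  exact div_nonneg (norm_nonneg _) (frobNorm_nonneg _)

theorem opNormRank_nonneg (k : ℕ) : 0 ≤ opNormRank k A := by
  refine Real.sSup_nonneg ?_
  rintro _ ⟨Y, -, -, rfl⟩
  exact div_nonneg (norm_nonneg _) (frobNorm_nonneg _)

theorem ric_nonneg (k : ℕ) : 0 ≤ ric A k :=
  Real.sInf_nonneg fun _ h => h.1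

theorem ric_spec {k : ℕ} {X : Matrix (Fin m) (Fin n) ℝ} (hXk : X.rank ≤ k) :
    (1 - ric A k) * frobNorm X ^ 2 ≤ ‖A X‖ ^ 2 ∧
      ‖A X‖ ^ 2 ≤ (1 + ric A k) * frobNorm X ^ 2 := by
  by_cases hX : X = 0
  · simp [hX, frobNorm_zero]
  have hF : 0 < frobNorm X ^ 2 := pow_pos (frobNorm_pos hX) 2
  obtain ⟨C, hC, h⟩ := exists_norm_le_mul_frobNorm A
  have hne : {δ : ℝ | 0 ≤ δ ∧ ∀ X : Matrix (Fin m) (Fin n) ℝ, X.rank ≤ k →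
      (1 - δ) * frobNorm X ^ 2 ≤ ‖A X‖ ^ 2 ∧
        ‖A X‖ ^ 2 ≤ (1 + δ) * frobNorm X ^ 2}.Nonempty := by
    -- With this constant the lower bound has coefficient `-C ^ 2` and is trivial.
    refine ⟨1 + C ^ 2, by positivity, fun Y _ => ⟨?_, ?_⟩⟩
    · have : 0 ≤ C ^ 2 * frobNorm Y ^ 2 := by positivity
      have := sq_nonneg ‖A Y‖
      nlinarith
    · have h1 := pow_le_pow_left₀ (norm_nonneg _) (h Y) 2
      rw [mul_pow] at h1
      have := sq_nonneg (frobNorm Y)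
      nlinarith
  constructor
  · have h1 : 1 - ‖A X‖ ^ 2 / frobNorm X ^ 2 ≤ ric A k := by
      refine le_csInf hne fun δ hδ => ?_
      have := (le_div_iff₀ hF).2 (hδ.2 X hXk).1
      linarith
    rw [← le_div_iff₀ hF]
    linarith
  · have h1 : ‖A X‖ ^ 2 / frobNorm X ^ 2 - 1 ≤ ric A k := by
      refine le_csInf hne fun δ hδ => ?_
      have := (div_le_iff₀ hF).2 (hδ.2 X hXk).2
      linarith
    rw [← div_le_iff₀ hF]
    linarith

theorem opNormRank_le_sqrt (k : ℕ) : opNormRank k A ≤ √(1 + ric A k) := by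
  refine Real.sSup_le ?_ (Real.sqrt_nonneg _)
  rintro _ ⟨Y, hY, hYk, rfl⟩
  rw [div_le_iff₀ (frobNorm_pos hY)]
  refine le_of_sq_le_sq ?_ (mul_nonneg (Real.sqrt_nonneg _) (frobNorm_nonneg Y))
  rw [mul_pow, Real.sq_sqrt (by linarith [ric_nonneg A k])]
  exact (ric_spec A hYk).2

variable {A E}

theorem hatDelta_nonneg {k : ℕ} {ε : ℝ} (hε : 0 ≤ ε) : 0 ≤ hatDelta A k ε := by
  rw [hatDelta]
  nlinarith [ric_nonneg A k, mul_nonneg (ric_nonneg A k) (sq_nonneg (1 + ε))]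

/-- Restricted isometry property of a perturbed measurement map. -/
theorem perturbed_rip {k : ℕ} {ε : ℝ} (hpos : 0 < opNormRank k A)
    (hε : opNormRank k E / opNormRank k A ≤ ε) {X : Matrix (Fin m) (Fin n) ℝ}
    (hXk : X.rank ≤ k) :
    (1 - hatDelta A k ε) * frobNorm X ^ 2 ≤ ‖(A + E) X‖ ^ 2 ∧
      ‖(A + E) X‖ ^ 2 ≤ (1 + hatDelta A k ε) * frobNorm X ^ 2 := by
  have hε0 : 0 ≤ ε := (div_nonneg (opNormRank_nonneg E k) hpos.le).trans hε
  have hδ0 := ric_nonneg A k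
  have hF := frobNorm_nonneg X
  set F := frobNorm X
  set δ := ric A k
  have hw := Real.sq_sqrt (show 0 ≤ 1 + δ by linarith)
  set w := √(1 + δ) with hwdef
  have hw0 : 0 ≤ w := Real.sqrt_nonneg _
  have hE : ‖E X‖ ≤ ε * w * F := by
    refine (norm_le_opNormRank_mul E hXk).trans (mul_le_mul_of_nonneg_right ?_ hF)
    rw [div_le_iff₀ hpos] at hε
    exact hε.trans (mul_le_mul_of_nonneg_left (opNormRank_le_sqrt A k) hε0)
  obtain ⟨hlo, hhi⟩ := ric_spec A hXk
  have hA : ‖A X‖ ≤ w * F := by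
    refine le_of_sq_le_sq ?_ (by positivity)
    rw [mul_pow, hw]
    exact hhi
  have hd : hatDelta A k ε = w ^ 2 * (1 + ε) ^ 2 - 1 := by rw [hatDelta, hw]
  rw [hd, LinearMap.add_apply]
  constructor
  · have h1 : ‖A X‖ - ‖E X‖ ≤ ‖A X + E X‖ := by
      have := norm_sub_le (A X + E X) (E X)
      rw [add_sub_cancel_right] at this
      linarith
    -- As `1 - δ = 2 - w²`, the left coefficient is `(1 - δ) - 2 ε w² - ε² w²`.
    have h2 : (1 - (w ^ 2 * (1 + ε) ^ 2 - 1)) * F ^ 2 ≤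
        ‖A X‖ ^ 2 - 2 * (ε * w * F) * (w * F) - (ε * w * F) ^ 2 := by
      nlinarith
    have hA0 := norm_nonneg (A X)
    have hE0 := norm_nonneg (E X)
    have h3 : ‖E X‖ * ‖A X‖ ≤ (ε * w * F) * (w * F) :=
      mul_le_mul hE hA hA0 (by positivity)
    -- Expanding the square stays valid when `‖A X‖ - ‖E X‖` is negative.
    have h4 : ‖A X‖ ^ 2 - 2 * (‖E X‖ * ‖A X‖) ≤ ‖A X + E X‖ ^ 2 := by
      have := real_inner_le_norm (A X) (-(E X))
      rw [inner_neg_right, norm_neg] at this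
      rw [norm_add_sq_real]
      nlinarith [sq_nonneg ‖E X‖]
    have h5 := sq_nonneg (ε * w * F)
    linarith
  · have h1 : ‖A X + E X‖ ≤ w * (1 + ε) * F :=
      (norm_add_le _ _).trans (by linarith)
    have h2 := pow_le_pow_left₀ (norm_nonneg _) h1 2
    refine h2.trans (le_of_eq (by ring))

theorem vectorRIP_of_forall_rank_le
    {B : Matrix (Fin m) (Fin n) ℝ →ₗ[ℝ] EuclideanSpace ℝ (Fin M)} {k : ℕ} {d : ℝ}
    (hB : ∀ X : Matrix (Fin m) (Fin n) ℝ, X.rank ≤ k →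
      (1 - d) * frobNorm X ^ 2 ≤ ‖B X‖ ^ 2 ∧ ‖B X‖ ^ 2 ≤ (1 + d) * frobNorm X ^ 2)
    {u : ℕ → Fin m → ℝ} {v : ℕ → Fin n → ℝ} {ρ : ℕ}
    (hu : ∀ i < ρ, ∀ j < ρ, u i ⬝ᵥ u j = if i = j then 1 else 0)
    (hv : ∀ i < ρ, ∀ j < ρ, v i ⬝ᵥ v j = if i = j then 1 else 0) :
    VectorRIP (fun i => B (Matrix.vecMulVec (u i) (v i))) ρ k d := by
  intro S c hS hc
  have h := hB (∑ i ∈ S, c i • Matrix.vecMulVec (u i) (v i))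
    ((rank_sum_vecMulVec_le u v S c).trans hS)
  rw [frobNorm_sq_sum_vecMulVec hu hv S c hc] at h
  simpa only [map_sum, map_smul] using h

theorem norm_apply_le_frobNorm_add_nuclearNorm {r : ℕ} (hr : 1 ≤ r)
    (Z : Matrix (Fin m) (Fin n) ℝ) :
    ‖A Z‖ ≤ √(1 + ric A r) * (frobNorm Z + nuclearNorm Z / √r) := by
  obtain ⟨u, v, hu, hv, hZ⟩ := exists_matrix_singular_vectors Z
  have h := (vectorRIP_of_forall_rank_le (fun X hX => ric_spec A hX) hu hv).norm_sum_le hr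
    (ric_nonneg A r) (matSingularValue_nonneg Z) (matSingularValue_antitone Z)
    (fun i hi => matSingularValue_eq_zero hi)
  have e : A Z = ∑ i ∈ Finset.range Z.rank,
      matSingularValue Z i • A (Matrix.vecMulVec (u i) (v i)) := by
    conv_lhs => rw [hZ]
    simp only [map_sum, map_smul]
  rw [← e, ← frobNorm_eq_sqrt_sum, sum_range_eq_of_forall_eq_zero (rank_le_min Z)
    _ (fun i hi => matSingularValue_eq_zero hi)] at h
  exact h

/-- Bound `E` by its rank-`r` norm on `Xr` and by its full norm on `X - Xr`. To make the result
relative to `‖A X‖`, bound `‖A X‖` below by `‖A Xr‖ - ‖A (X - Xr)‖`; this produces the factor `1 - κ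
(t + s)`. -/
theorem norm_apply_sub_le_totalNoise {z : EuclideanSpace ℝ (Fin M)}
    {X Xr : Matrix (Fin m) (Fin n) ℝ} {r : ℕ} {εA εr εy : ℝ} (hr : 1 ≤ r) (hXr0 : Xr ≠ 0)
    (hXr : Xr.rank ≤ r) (hδ : ric A r < 1)
    (hεA : opNorm E / opNorm A ≤ εA) (hεr : opNormRank r E / opNormRank r A ≤ εr)
    (hεy : ‖z‖ / ‖A X‖ ≤ εy)
    (htail : tailRatioF X Xr + tailRatioNuc r X Xr < 1 / kappa A r) :
    ‖E X - z‖ ≤ totalNoise A r X Xr εA εr εy := by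
  have hδ0 := ric_nonneg A r
  have hr0 : (0 : ℝ) < r := by exact_mod_cast hr
  have hsr : 0 < √(r : ℝ) := Real.sqrt_pos.2 hr0
  have hF := frobNorm_pos hXr0
  have hc : 0 < √(1 - ric A r) := Real.sqrt_pos.2 (by linarith)
  have hw : 0 < √(1 + ric A r) := Real.sqrt_pos.2 (by linarith)
  have hlo : √(1 - ric A r) * frobNorm Xr ≤ ‖A Xr‖ := by
    refine le_of_sq_le_sq ?_ (norm_nonneg _)
    rw [mul_pow, Real.sq_sqrt (by linarith)]
    exact (ric_spec A hXr).1
  have hAXr : 0 < ‖A Xr‖ := (mul_pos hc hF).trans_le hlo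
  have hopr : 0 < opNormRank r A := by
    by_contra hcon
    have := norm_le_opNormRank_mul A hXr
    nlinarith [mul_nonneg (sub_nonneg.2 (not_lt.1 hcon)) hF.le]
  have hop : 0 < opNorm A := by
    by_contra hcon
    have := norm_le_opNorm_mul A Xr
    nlinarith [mul_nonneg (sub_nonneg.2 (not_lt.1 hcon)) hF.le]
  have hεr0 : 0 ≤ εr := (div_nonneg (opNormRank_nonneg E r) hopr.le).trans hεr
  set t := tailRatioF X Xr with ht
  set s := tailRatioNuc r X Xr with hs
  set κ := kappa A r with hκ
  have hκe : κ = √(1 + ric A r) / √(1 - ric A r) := rfl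
  have hκ0 : 0 < κ := div_pos hw hc
  have hden : 0 < 1 - κ * (t + s) := by
    rw [lt_div_iff₀ hκ0] at htail
    linarith
  have htF : frobNorm (X - Xr) = t * frobNorm Xr := by
    rw [ht, tailRatioF]; field_simp
  have hsN : nuclearNorm (X - Xr) / √r = s * frobNorm Xr := by
    rw [hs, tailRatioNuc]; field_simp
  have hAX : √(1 - ric A r) * frobNorm Xr * (1 - κ * (t + s)) ≤ ‖A X‖ := by
    have h1 := norm_apply_le_frobNorm_add_nuclearNorm (A := A) hr (X - Xr)
    rw [htF, hsN] at h1
    have h2 : ‖A Xr‖ - ‖A (X - Xr)‖ ≤ ‖A X‖ := by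
      have := norm_sub_le (A X) (A (X - Xr))
      rw [← map_sub, sub_sub_cancel] at this
      linarith
    have e : √(1 - ric A r) * frobNorm Xr * (1 - κ * (t + s)) =
        √(1 - ric A r) * frobNorm Xr -
          √(1 + ric A r) * (t * frobNorm Xr + s * frobNorm Xr) := by
      rw [hκe]; field_simp
    linarith
  have hAX0 : 0 < ‖A X‖ := (mul_pos (mul_pos hc hF) hden).trans_le hAX
  have hz : ‖z‖ ≤ εy * ‖A X‖ := (div_le_iff₀ hAX0).1 hεy
  have ht0 : 0 ≤ t := div_nonneg (frobNorm_nonneg _) (frobNorm_nonneg _)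
  have hεA0 : 0 ≤ εA := (div_nonneg (opNorm_nonneg E) hop.le).trans hεA
  have hEX : ‖E X‖ ≤ (εr * √(1 + ric A r) + εA * opNorm A * t) * frobNorm Xr := by
    have h1 : ‖E Xr‖ ≤ εr * √(1 + ric A r) * frobNorm Xr := by
      refine (norm_le_opNormRank_mul E hXr).trans (mul_le_mul_of_nonneg_right ?_ hF.le)
      exact ((div_le_iff₀ hopr).1 hεr).trans
        (mul_le_mul_of_nonneg_left (opNormRank_le_sqrt A r) hεr0)
    have h2 : ‖E (X - Xr)‖ ≤ εA * opNorm A * (t * frobNorm Xr) := by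
      rw [← htF]
      refine (norm_le_opNorm_mul E _).trans (mul_le_mul_of_nonneg_right ?_ (frobNorm_nonneg _))
      exact (div_le_iff₀ hop).1 hεA
    have h3 : ‖E X‖ ≤ ‖E Xr‖ + ‖E (X - Xr)‖ := by
      have := norm_add_le (E Xr) (E (X - Xr))
      rwa [← map_add, add_sub_cancel] at this
    linarith
  have hnum : 0 ≤ εr * κ + εA * alphaConst A r * t := by
    have : 0 ≤ alphaConst A r := div_nonneg hop.le hc.le
    positivity
  have hEX' : ‖E X‖ ≤ (εr * κ + εA * alphaConst A r * t) / (1 - κ * (t + s)) * ‖A X‖ := by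
    refine hEX.trans (le_trans (le_of_eq ?_)
      (mul_le_mul_of_nonneg_left hAX (div_nonneg hnum hden.le)))
    rw [alphaConst, hκe]
    rw [hκe] at hden
    have hne := hden.ne'
    have hc' := hc.ne'
    set D := 1 - √(1 + ric A r) / √(1 - ric A r) * (t + s)
    field_simp
  rw [totalNoise, add_mul]
  exact (norm_sub_le _ _).trans (add_le_add hEX' hz)

end OperatorBounds

end

/-! ### Tail bound from minimality, and the main theorem. -/

theorem sum_tail_rpow_matSingularValue_le {m n : ℕ} {p : ℝ} (hp0 : 0 < p) (hp1 : p ≤ 1) {r : ℕ}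
    {X Xr Y : Matrix (Fin m) (Fin n) ℝ} (hXr : Xr.rank ≤ r)
    (hY : schattenNorm p Y ^ p ≤ schattenNorm p X ^ p) (N : ℕ) :
    ∑ i ∈ Finset.Ico r N, matSingularValue (X - Y) i ^ p ≤
      ∑ i ∈ Finset.range r, matSingularValue (X - Y) i ^ p +
        2 * schattenNorm p (X - Xr) ^ p := by
  have hz : ∀ (Z : Matrix (Fin m) (Fin n) ℝ) (i : ℕ), min m n ≤ i →
      matSingularValue Z i ^ p = 0 := fun Z i hi => by
    rw [matSingularValue_eq_zero ((rank_le_min Z).trans hi), Real.zero_rpow hp0.ne']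
  have h0 : ∀ (Z : Matrix (Fin m) (Fin n) ℝ) (i : ℕ), 0 ≤ matSingularValue Z i ^ p :=
    fun Z i => Real.rpow_nonneg (matSingularValue_nonneg Z i) p
  have hYS := sum_abs_rpow_matSingularValue_sub_le hp0.le hp1 X (X - Y)
  rw [sub_sub_cancel] at hYS
  rw [schattenNorm_rpow hp0, schattenNorm_rpow hp0] at hY
  have h1 := hYS.trans hY
  set a := fun i => matSingularValue X i ^ p with ha
  set b := fun i => matSingularValue (X - Y) i ^ p with hb
  set K := min m n with hK
  have hKN : K ≤ r + (N + K) := by omega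
  rw [sum_range_eq_of_forall_eq_zero hKN (fun i => |a i - b i|)
      (fun i hi => by simp only [ha, hb, hz _ i hi, sub_zero, abs_zero]),
    sum_range_eq_of_forall_eq_zero hKN a (fun i hi => hz _ i hi),
    ← Finset.sum_range_add_sum_Ico _ (show r ≤ r + (N + K) by omega),
    ← Finset.sum_range_add_sum_Ico _ (show r ≤ r + (N + K) by omega)] at h1
  -- Resolving the absolute values as `a - b` on the head and `b - a` on the tail cancels the head
  -- of `a` against `‖X‖_p^p`. Twice the tail of `a` remains, and Weyl bounds that tail by `‖X -
  -- Xr‖_p^p`.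
  have h2 : ∑ i ∈ Finset.range r, (a i - b i) ≤ ∑ i ∈ Finset.range r, |a i - b i| :=
    Finset.sum_le_sum fun i _ => le_abs_self _
  have h3 : ∑ i ∈ Finset.Ico r (r + (N + K)), (b i - a i) ≤
      ∑ i ∈ Finset.Ico r (r + (N + K)), |a i - b i| :=
    Finset.sum_le_sum fun i _ => by rw [abs_sub_comm]; exact le_abs_self _
  rw [Finset.sum_sub_distrib] at h2 h3
  have h4 : ∑ i ∈ Finset.Ico r (r + (N + K)), a i ≤ schattenNorm p (X - Xr) ^ p := by
    rw [schattenNorm_rpow hp0, sum_range_eq_of_forall_eq_zero (show K ≤ N + K by omega)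
      (fun i => matSingularValue (X - Xr) i ^ p) (fun i hi => hz _ i hi), Finset.sum_Ico_eq_sum_range,
      Nat.add_sub_cancel_left]
    refine Finset.sum_le_sum fun i _ => ?_
    refine Real.rpow_le_rpow (matSingularValue_nonneg _ _) ?_ hp0.le
    rw [add_comm]
    exact matSingularValue_add_rank_le X Xr hXr i
  have h5 : ∑ i ∈ Finset.Ico r N, b i ≤ ∑ i ∈ Finset.Ico r (r + (N + K)), b i :=
    Finset.sum_le_sum_of_subset_of_nonneg (Finset.Ico_subset_Ico_right (by omega))
      fun i _ _ => h0 _ i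
  linarith

theorem theorem1 {m n M : ℕ}
    (A E : Matrix (Fin m) (Fin n) ℝ →ₗ[ℝ] EuclideanSpace ℝ (Fin M))
    (z : EuclideanSpace ℝ (Fin M))
    (X Xr Xstar : Matrix (Fin m) (Fin n) ℝ)
    (p a : ℝ) (r k : ℕ) (εA εr ε₁ ε₂ εy : ℝ)
    (hp0 : 0 < p) (hp1 : p < 1) (hr : 1 ≤ r)
    (ha : 1 < a) (hk : (k : ℝ) = a * r)
    (hX : X ≠ 0) (hXr : IsBestRankApprox r X Xr)
    (hεA : opNorm E / opNorm A ≤ εA)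
    (hεr : opNormRank r E / opNormRank r A ≤ εr)
    (hε₁ : opNormRank (k + r) E / opNormRank (k + r) A ≤ ε₁)
    (hε₂ : opNormRank (2 * k) E / opNormRank (2 * k) A ≤ ε₂)
    (hεy : ‖z‖ / ‖A X‖ ≤ εy)
    (hmono : hatDelta A (k + r) ε₁ ≤ hatDelta A (2 * k) ε₂)
    (hric : ric A (2 * k) <
      (2 + Real.sqrt 2 * a ^ (1 / 2 - 1 / p)) /
        ((1 + Real.sqrt 2 * a ^ (1 / 2 - 1 / p)) * (1 + ε₂) ^ 2) - 1)
    (htail : tailRatioF X Xr + tailRatioNuc r X Xr < 1 / kappa A r)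
    (hmin : IsSchattenMinimizer p (A + E) (A X + z) (totalNoise A r X Xr εA εr εy) Xstar) :
    hatDelta A (k + r) ε₁ < 1 ∧
    0 < errDenom p a (hatDelta A (k + r) ε₁) (hatDelta A (2 * k) ε₂) ∧
    frobNorm (X - Xstar) ^ p ≤
      errC1 p a (hatDelta A (k + r) ε₁) (hatDelta A (2 * k) ε₂) *
          totalNoise A r X Xr εA εr εy ^ p +
        errC2 p a (hatDelta A (k + r) ε₁) (hatDelta A (2 * k) ε₂) *
          (schattenNorm p (X - Xr) ^ p / (r : ℝ) ^ (1 - p / 2)) ∧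
    schattenNorm p (X - Xstar) ^ p ≤
      errC1' p a (hatDelta A (k + r) ε₁) (hatDelta A (2 * k) ε₂) *
          (r : ℝ) ^ (1 - p / 2) * totalNoise A r X Xr εA εr εy ^ p +
        errC2' p a (hatDelta A (k + r) ε₁) (hatDelta A (2 * k) ε₂) *
          schattenNorm p (X - Xr) ^ p := by
  -- If `δ_r ≥ 1`, the square root in the denominator of `kappa` is zero, so `1 / kappa` evaluates
  -- to `0`, which `htail` excludes.
  have hδ : ric A r < 1 := by
    by_contra hcon
    have hκ : kappa A r = 0 := by
      rw [kappa, Real.sqrt_eq_zero_of_nonpos (show 1 - ric A r ≤ 0 by linarith), div_zero]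
    rw [hκ, div_zero] at htail
    have h1 : 0 ≤ tailRatioF X Xr := div_nonneg (frobNorm_nonneg _) (frobNorm_nonneg _)
    have h2 : 0 ≤ tailRatioNuc r X Xr :=
      div_nonneg (Finset.sum_nonneg fun i _ => matSingularValue_nonneg _ i)
        (mul_nonneg (Real.sqrt_nonneg _) (frobNorm_nonneg _))
    linarith
  have hXr0 := best_rank_approx_ne_zero hr hX hXr
  have hrk : r ≤ k := by
    have hr' : (0 : ℝ) ≤ r := Nat.cast_nonneg r
    have : (r : ℝ) ≤ k := by rw [hk]; nlinarith
    exact_mod_cast this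
  -- Needed to clear denominators in the relative bounds on `E`: the nonzero matrix `Xr` is not
  -- annihilated by `A`, since `δ_r < 1`.
  have hop : ∀ l, r ≤ l → 0 < opNormRank l A := by
    intro l hl
    have hF := frobNorm_pos hXr0
    have h1 := (ric_spec A hXr.1).1
    have h2 := norm_le_opNormRank_mul A (hXr.1.trans hl)
    have h3 : 0 < ‖A Xr‖ ^ 2 := (mul_pos (by linarith) (pow_pos hF 2)).trans_le h1
    have h4 : 0 < ‖A Xr‖ := by
      refine (norm_nonneg _).lt_of_ne fun h => ?_
      rw [← h] at h3
      simp at h3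
    exact pos_of_mul_pos_left (h4.trans_le h2) hF.le
  have hε₁0 : 0 ≤ ε₁ :=
    (div_nonneg (opNormRank_nonneg E _) (opNormRank_nonneg A _)).trans hε₁
  have hε₂0 : 0 ≤ ε₂ :=
    (div_nonneg (opNormRank_nonneg E _) (opNormRank_nonneg A _)).trans hε₂
  have hd₁ : 0 ≤ hatDelta A (k + r) ε₁ := hatDelta_nonneg hε₁0
  have hd₂ : 1 + hatDelta A (2 * k) ε₂ < (2 + √2 * a ^ (1 / 2 - 1 / p)) /
      (1 + √2 * a ^ (1 / 2 - 1 / p)) := by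
    have hsq : 0 < (1 + ε₂) ^ 2 := by positivity
    rw [← div_div, lt_sub_iff_add_lt, lt_div_iff₀ hsq] at hric
    rw [hatDelta]
    linarith
  obtain ⟨hlt, hD⟩ := hatDelta_bounds_of_lt hp0 (by linarith) hd₁ hmono hd₂
  refine ⟨hlt, hD, ?_⟩
  have hfeas := norm_apply_sub_le_totalNoise hr hXr0 hXr.1 hδ hεA hεr hεy htail
  set η := totalNoise A r X Xr εA εr εy
  have hXfeas : ‖(A + E) X - (A X + z)‖ ≤ η := by
    rw [LinearMap.add_apply, add_sub_add_left_eq_sub]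
    exact hfeas
  have hη : 0 ≤ η := (norm_nonneg _).trans hfeas
  have htailσ := sum_tail_rpow_matSingularValue_le hp0 hp1.le hXr.1 (hmin.2 X hXfeas)
  obtain ⟨u, v, hu, hv, hH⟩ := exists_matrix_singular_vectors (X - Xstar)
  have hBH : ‖(A + E) (X - Xstar)‖ ≤ 2 * η := by
    have h1 := norm_sub_le ((A + E) X - (A X + z)) ((A + E) Xstar - (A X + z))
    rw [sub_sub_sub_cancel_right, ← map_sub] at h1
    linarith [hmin.1]
  have e : (A + E) (X - Xstar) = ∑ i ∈ Finset.range (X - Xstar).rank,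
      matSingularValue (X - Xstar) i • (A + E) (Matrix.vecMulVec (u i) (v i)) := by
    conv_lhs => rw [hH]
    simp only [map_sum, map_smul]
  rw [e] at hBH
  have hmain := recovery_bounds hp0 hp1.le hr ha hk
    (vectorRIP_of_forall_rank_le
      (fun Z hZ => perturbed_rip (hop _ (by omega)) hε₁ hZ) hu hv)
    (vectorRIP_of_forall_rank_le
      (fun Z hZ => perturbed_rip (hop _ (by omega)) hε₂ hZ) hu hv)
    hd₁ hlt hD (matSingularValue_nonneg (X - Xstar)) (matSingularValue_antitone _)
    (fun i hi => matSingularValue_eq_zero hi) hη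
    (τ := schattenNorm p (X - Xr) ^ p)
    (by
      rw [schattenNorm_rpow hp0]
      exact Finset.sum_nonneg fun i _ => Real.rpow_nonneg (matSingularValue_nonneg _ i) p)
    hBH htailσ
  rw [frobNorm_eq_sqrt_sum, schattenNorm_rpow hp0 (X - Xstar),
    ← sum_range_eq_of_forall_eq_zero (rank_le_min (X - Xstar))
      (fun i => matSingularValue (X - Xstar) i ^ p)
      (fun i hi => by rw [matSingularValue_eq_zero hi, Real.zero_rpow hp0.ne'])]
  exact hmain
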